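/- Let $\mathcal D$ be the family of dyadic intervals $[k2^n,(k+1)2^n)$, $k,n\in\mathbb Z$, of the real line, and write $\langle h\rangle_I=\frac1{|I|}\int_I h\,dx$. Let $v,w$ be weights on $\mathbb R$, i.e. nonnegative locally integrable functions (where $w=0$ we put $w^{-1}=\infty$, so functions in $L^2(w^{-1})$ vanish a.e. on $\{w=0\}$), and let $\{\alpha_I\}_{I\in\mathcal D}$ be a family of nonnegative real numbers. Put $$T_0f=\sum_{I\in\mathcal D}\frac1{|I|}\langle f\rangle_I\,\chi_I\,\alpha_I ,\qquad k(x,y)=\sum_{I\in\mathcal D}\frac1{|I|^2}\chi_I(x)\chi_I(y)\alpha_I ,$$ so that $T_0$ is the integral operator with kernel $k$. The following assertions are equivalent: 1) $T_0$ is a bounded operator from $L^2(w^{-1})$ to $L^2(v)$ (for each $f\in L^2(w^{-1})$ the series for $T_0f$ converges absolutely $v\,dx$-a.e.); 2) there is $C<\infty$ such that for all $f,g\in L^2(\mathbb R)$ the following series converges absolutely and $$\sum_{I\in\mathcal D}\langle gv^{1/2}\rangle_I\,\langle fw^{1/2}\rangle_I\,\alpha_I\le C\|g\|_2\|f\|_2;$$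 3) there is $C<\infty$ such that for every measurable $G\ge 0$ $$\int_{\mathbb R}\Bigl(\int_{\mathbb R}k(x,y)G(y)w(y)\,dy\Bigr)^2v(x)\,dx\le C\int_{\mathbb R}G^2w\,dy;$$ 4) there is $C<\infty$ such that for every $J\in\mathcal D$ $$\frac1{|J|}\int_J\Bigl(\sum_{I\in\mathcal D,\,I\subseteq J}\frac1{|I|}\chi_I\langle w\rangle_I\alpha_I\Bigr)^2v\,dx\le C\langle w\rangle_J \quad\text{and}\quad \frac1{|J|}\int_J\Bigl(\sum_{I\in\mathcal D,\,I\subseteq J}\frac1{|I|}\chi_I\langle v\rangle_I\alpha_I\Bigr)^2w\,dx\le C\langle v\rangle_J .$$ -/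

import Mathlib

open MeasureTheory
open scoped ENNReal NNReal

noncomputable section

namespace DyadicTwoWeight

/-- An index `(n, k)` for the dyadic interval `[k 2^n, (k+1) 2^n)` of the real line. Different
indices give different intervals, so this type is the family `𝒟` of all dyadic intervals. -/
structure DyadicInterval where
  scale : ℤ
  pos : ℤ

namespace DyadicInterval

/-- The length `|I| = 2^n`. -/
def length (I : DyadicInterval) : ℝ≥0 := (2 : ℝ≥0) ^ I.scale

/-- The interval itself, as a subset of `ℝ`. -/
def toSet (I : DyadicInterval) : Set ℝ :=
  Set.Ico ((I.pos : ℝ) * (2 : ℝ) ^ I.scale) (((I.pos : ℝ) + 1) * (2 : ℝ) ^ I.scale)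

end DyadicInterval

/-- A weight: a nonnegative, (Borel) measurable, locally integrable function on the line. -/
structure IsWeight (w : ℝ → ℝ≥0) : Prop where
  measurable : Measurable w
  locallyIntegrable : LocallyIntegrable (fun x => (w x : ℝ)) volume

/-- The measure `v dx`. -/
def weightMeasure (v : ℝ → ℝ≥0) : Measure ℝ :=
  volume.withDensity fun x => (v x : ℝ≥0∞)

/-- The measure `w⁻¹ dx`. The inverse is taken in `[0, ∞]`, so the density is `∞` where `w = 0`
and the members of `L²(w⁻¹)` vanish a.e. there. (If `w > 0` a.e., this plays no role.) -/
def invWeightMeasure (w : ℝ → ℝ≥0) : Measure ℝ :=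
  volume.withDensity fun x => (w x : ℝ≥0∞)⁻¹

/-- The summand `|I|⁻¹ ⟨f⟩_I χ_I(x) α_I` of `T₀ f (x)`. -/
def T0term (α : DyadicInterval → ℝ≥0) (f : ℝ → ℝ) (x : ℝ) (I : DyadicInterval) : ℝ :=
  (I.length : ℝ)⁻¹ * (⨍ y in I.toSet, f y) * I.toSet.indicator 1 x * (α I : ℝ)

/-- `T₀ f = ∑_I |I|⁻¹ ⟨f⟩_I χ_I α_I` is a bounded operator from `L²(w⁻¹)` to `L²(v)`: the series
converges (unconditionally) at `v`-almost every point for every `f ∈ L²(w⁻¹)`, and its sum is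
given by a continuous linear map `L²(w⁻¹) → L²(v)`. -/
def T0Bounded (v w : ℝ → ℝ≥0) (α : DyadicInterval → ℝ≥0) : Prop :=
  ∃ T : Lp ℝ 2 (invWeightMeasure w) →L[ℝ] Lp ℝ 2 (weightMeasure v),
    ∀ f : Lp ℝ 2 (invWeightMeasure w),
      ∀ᵐ x ∂(weightMeasure v), HasSum (T0term α f x) (T f x)

/-- The bilinear weighted embedding
`∑_I ⟨g v^{1/2}⟩_I ⟨f w^{1/2}⟩_I α_I ≤ C ‖g‖₂ ‖f‖₂` for all `f, g ∈ L²(ℝ)`,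
convergence of the series being part of the assertion. -/
def BilinearEmbedding (v w : ℝ → ℝ≥0) (α : DyadicInterval → ℝ≥0) : Prop :=
  ∃ C : ℝ≥0, ∀ f g : Lp ℝ 2 (volume : Measure ℝ),
    Summable (fun I : DyadicInterval =>
      (⨍ x in I.toSet, g x * Real.sqrt (v x)) * (⨍ x in I.toSet, f x * Real.sqrt (w x)) *
        (α I : ℝ)) ∧
    ∑' I : DyadicInterval,
      (⨍ x in I.toSet, g x * Real.sqrt (v x)) * (⨍ x in I.toSet, f x * Real.sqrt (w x)) *
        (α I : ℝ) ≤ C * ‖g‖ * ‖f‖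

/-- The kernel `k(x, y) = ∑_I |I|⁻² χ_I(x) χ_I(y) α_I`, with values in `[0, ∞]`. -/
def kernel (α : DyadicInterval → ℝ≥0) (x y : ℝ) : ℝ≥0∞ :=
  ∑' I : DyadicInterval,
    ((I.length : ℝ≥0∞) ^ 2)⁻¹ * I.toSet.indicator 1 x * I.toSet.indicator 1 y * (α I : ℝ≥0∞)

/-- `∫ (∫ k(x, y) G(y) w(y) dy)² v(x) dx ≤ C ∫ G² w dy` for all nonnegative measurable `G`. -/
def KernelInequality (v w : ℝ → ℝ≥0) (α : DyadicInterval → ℝ≥0) : Prop :=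
  ∃ C : ℝ≥0, ∀ G : ℝ → ℝ≥0∞, Measurable G →
    ∫⁻ x, (∫⁻ y, kernel α x y * G y * (w y : ℝ≥0∞)) ^ 2 * (v x : ℝ≥0∞)
      ≤ C * ∫⁻ y, G y ^ 2 * (w y : ℝ≥0∞)

/-- The testing condition, with constant `C`:
`|J|⁻¹ ∫_J (∑_{I ⊆ J} |I|⁻¹ χ_I ⟨w⟩_I α_I)² v dx ≤ C ⟨w⟩_J` for every dyadic `J`. -/
def TestingCondition (v w : ℝ → ℝ≥0) (α : DyadicInterval → ℝ≥0) (C : ℝ≥0) : Prop :=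
  ∀ J : DyadicInterval,
    ⨍⁻ x in J.toSet,
      (∑' I : {I : DyadicInterval // I.toSet ⊆ J.toSet},
        (I.1.length : ℝ≥0∞)⁻¹ * I.1.toSet.indicator 1 x *
          (⨍⁻ y in I.1.toSet, (w y : ℝ≥0∞) ∂volume) * (α I.1 : ℝ≥0∞)) ^ 2 * (v x : ℝ≥0∞) ∂volume
      ≤ C * ⨍⁻ y in J.toSet, (w y : ℝ≥0∞) ∂volume

end DyadicTwoWeight

end

/-! Put σ = w dx, μ = v dx and a_I = α_I/|I|². The substitutions f = Gw in L²(w⁻¹) and g = φ v^{1/2}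
in L²(dx) turn 1), 2), 3) into bounds for one positive operator G ↦ ∑ a_I (∫_I G dσ) χ_I from L²(σ)
to L²(μ), or for its bilinear form. Positivity reduces signed functions to their absolute values.
Condition 4) tests the operator and its adjoint on χ_J, keeping only the I ⊆ J. Operator bound to
form bound is Cauchy–Schwarz; form bound to testing comes from pairing χ_J with the local sum
itself.

The substance is that testing implies boundedness, proved by a Bellman-type induction over the
dyadic tree (`tree_bound`), with testing constants normalized to 1. Let m = x/s and n = y/u be the
averages over J of φ for σ and of ψ for μ, let S be the bilinear sum below J, and let L = ∑_{I ⊆ J}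
a_I σ(I) μ(I). In S − mnL the term of J cancels, so passing from the halves to J only costs the
change of mnL with L frozen on the halves. By `average_product_le` this change is at most the
variances of m and n, which telescope through x²/s + y²/u, plus m²D/2 + n²E/2.

Here D is the growth, from the halves to J, of the μ-variance V of the local sum (`variance_step`);
E and W play this role with σ and μ exchanged. Testing gives V ≤ s, so the numbers D form a Carleson
sequence, and the term 2x²/(s + V) pays for m²D/2 (`carleson_step`). Below all the intervals in play
the potential is 3(x²/s + y²/u) ≤ 3(X + Y), with X = ∫_J φ² dσ and Y = ∫_J ψ² dμ. Finally a
rescaling turns this additive bound into the operator bound (`TestBound.opBound`). -/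

noncomputable section

namespace DyadicTwoWeight

open DyadicInterval

/-! ### The dyadic tree: halves, ancestors, finite families and induction. -/

namespace DyadicInterval

theorem eq_of_scale_of_pos {I J : DyadicInterval} (h₁ : I.scale = J.scale) (h₂ : I.pos = J.pos) :
    I = J := by
  cases I; cases J; simp_all

instance : Countable DyadicInterval :=
  Function.Injective.countable (f := fun I : DyadicInterval => (I.scale, I.pos)) fun I J h => by
    simp only [Prod.mk.injEq] at h
    exact eq_of_scale_of_pos h.1 h.2

instance : DecidableEq DyadicInterval := Classical.decEq _

theorem mem_toSet_iff_floor (I : DyadicInterval) (x : ℝ) :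
    x ∈ I.toSet ↔ ⌊x / (2 : ℝ) ^ I.scale⌋ = I.pos := by
  have h : (0 : ℝ) < 2 ^ I.scale := by positivity
  rw [toSet, Set.mem_Ico, Int.floor_eq_iff, le_div_iff₀ h, div_lt_iff₀ h]

theorem measurableSet_toSet (I : DyadicInterval) : MeasurableSet I.toSet := measurableSet_Ico

theorem volume_toSet (I : DyadicInterval) : volume I.toSet = (I.length : ℝ≥0∞) := by
  rw [toSet, Real.volume_Ico, length]
  have : ((I.pos : ℝ) + 1) * (2 : ℝ) ^ I.scale - (I.pos : ℝ) * (2 : ℝ) ^ I.scale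
      = (((2 : ℝ≥0) ^ I.scale : ℝ≥0) : ℝ) := by push_cast; ring
  rw [this, ENNReal.ofReal_coe_nnreal]

theorem length_ne_zero (I : DyadicInterval) : I.length ≠ 0 := by
  unfold length; positivity

theorem toSet_nonempty (I : DyadicInterval) : I.toSet.Nonempty := by
  rw [toSet, Set.nonempty_Ico]
  have h : (0 : ℝ) < 2 ^ I.scale := by positivity
  nlinarith

/-- The dyadic interval of twice the length that contains `I`. -/
def parent (I : DyadicInterval) : DyadicInterval := ⟨I.scale + 1, I.pos / 2⟩

/-- The left half. -/
def left (I : DyadicInterval) : DyadicInterval := ⟨I.scale - 1, 2 * I.pos⟩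

/-- The right half. -/
def right (I : DyadicInterval) : DyadicInterval := ⟨I.scale - 1, 2 * I.pos + 1⟩

theorem toSet_subset_parent (I : DyadicInterval) : I.toSet ⊆ I.parent.toSet := by
  intro x hx
  rw [mem_toSet_iff_floor] at hx ⊢
  have : x / (2 : ℝ) ^ (I.scale + 1) = x / 2 ^ I.scale / (2 : ℕ) := by
    rw [zpow_add₀ (by norm_num), div_div, zpow_one, Nat.cast_ofNat]
  simp only [parent]
  rw [this, Int.floor_div_natCast, hx, Nat.cast_ofNat]

theorem eq_left_or_right {I J : DyadicInterval} (h : I.parent = J) : I = J.left ∨ I = J.right := by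
  subst h
  rcases Int.emod_two_eq_zero_or_one I.pos with h | h
  · left; apply eq_of_scale_of_pos <;> simp only [left, parent] <;> omega
  · right; apply eq_of_scale_of_pos <;> simp only [right, parent] <;> omega

theorem parent_left (J : DyadicInterval) : J.left.parent = J := by
  apply eq_of_scale_of_pos <;> simp only [left, parent] <;> omega

theorem parent_right (J : DyadicInterval) : J.right.parent = J := by
  apply eq_of_scale_of_pos <;> simp only [right, parent] <;> omega

theorem left_subset (J : DyadicInterval) : J.left.toSet ⊆ J.toSet := by
  conv_rhs => rw [← J.parent_left]
  exact toSet_subset_parent _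

theorem right_subset (J : DyadicInterval) : J.right.toSet ⊆ J.toSet := by
  conv_rhs => rw [← J.parent_right]
  exact toSet_subset_parent _

theorem eq_of_scale_eq {I J : DyadicInterval} (h : I.scale = J.scale) {x : ℝ}
    (hI : x ∈ I.toSet) (hJ : x ∈ J.toSet) : I = J := by
  rw [mem_toSet_iff_floor] at hI hJ
  refine eq_of_scale_of_pos h ?_
  rw [← hI, ← hJ, h]

theorem disjoint_left_right (J : DyadicInterval) : Disjoint J.left.toSet J.right.toSet := by
  refine Set.disjoint_left.2 fun x h₁ h₂ => ?_
  have := congrArg pos (eq_of_scale_eq (I := J.left) (J := J.right) rfl h₁ h₂)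
  simp [left, right] at this

theorem left_union_right (J : DyadicInterval) : J.left.toSet ∪ J.right.toSet = J.toSet := by
  refine Set.Subset.antisymm (Set.union_subset J.left_subset J.right_subset) fun x hx => ?_
  let K : DyadicInterval := ⟨J.scale - 1, ⌊x / (2 : ℝ) ^ (J.scale - 1)⌋⟩
  have hK : x ∈ K.toSet := by rw [mem_toSet_iff_floor]
  have : K.parent = J :=
    eq_of_scale_eq (by simp [parent, K]) (K.toSet_subset_parent hK) hx
  rcases eq_left_or_right this with h | h
  · exact Or.inl (h ▸ hK)
  · exact Or.inr (h ▸ hK)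

/-- The ancestor of `I` of scale `I.scale + d`. -/
def ancestor (d : ℕ) (I : DyadicInterval) : DyadicInterval := parent^[d] I

theorem ancestor_succ (d : ℕ) (I : DyadicInterval) :
    ancestor (d + 1) I = (ancestor d I).parent := Function.iterate_succ_apply' ..

theorem scale_ancestor (d : ℕ) (I : DyadicInterval) : (ancestor d I).scale = I.scale + d := by
  induction d with
  | zero => simp [ancestor]
  | succ d ih => rw [ancestor_succ, parent]; simp only [ih]; push_cast; ring

theorem subset_ancestor (d : ℕ) (I : DyadicInterval) : I.toSet ⊆ (ancestor d I).toSet := by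
  induction d with
  | zero => simp [ancestor]
  | succ d ih => rw [ancestor_succ]; exact ih.trans (toSet_subset_parent _)

theorem scale_le_of_subset {I J : DyadicInterval} (h : I.toSet ⊆ J.toSet) :
    I.scale ≤ J.scale := by
  have := measure_mono (μ := volume) h
  rw [volume_toSet, volume_toSet, ENNReal.coe_le_coe, length, length] at this
  exact (zpow_le_zpow_iff_right₀ (by norm_num)).1 this

/-- Climb from I to its ancestor of the scale of J. The two share a point, so they coincide; the
last step of the climb then starts from a half of J. -/
theorem subset_iff {I J : DyadicInterval} :
    I.toSet ⊆ J.toSet ↔ I = J ∨ I.toSet ⊆ J.left.toSet ∨ I.toSet ⊆ J.right.toSet := by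
  constructor
  · intro h
    have hs := scale_le_of_subset h
    obtain ⟨d, hd⟩ := Int.le.dest hs
    obtain ⟨x, hx⟩ := I.toSet_nonempty
    have hJ : ancestor d I = J :=
      eq_of_scale_eq (by rw [scale_ancestor, hd]) (subset_ancestor d I hx) (h hx)
    rcases d with _ | d
    · exact Or.inl hJ
    · rw [ancestor_succ] at hJ
      rcases eq_left_or_right hJ with h | h
      · exact Or.inr (Or.inl (h ▸ subset_ancestor d I))
      · exact Or.inr (Or.inr (h ▸ subset_ancestor d I))
  · rintro (rfl | h | h)
    · exact subset_rfl
    · exact h.trans J.left_subset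
    · exact h.trans J.right_subset

open Classical in
/-- The members of `F` contained in `J`. -/
def below (F : Finset DyadicInterval) (J : DyadicInterval) : Finset DyadicInterval :=
  F.filter fun I => I.toSet ⊆ J.toSet

theorem mem_below {F : Finset DyadicInterval} {I J : DyadicInterval} :
    I ∈ below F J ↔ I ∈ F ∧ I.toSet ⊆ J.toSet := by simp [below]

/-- A sum over the members of `F` in `J` splits into the term of `J` and the sums over the
two halves. -/
theorem sum_below {M : Type*} [AddCommMonoid M] (F : Finset DyadicInterval)
    (f : DyadicInterval → M) (hf : ∀ I, I ∉ F → f I = 0) (J : DyadicInterval) :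
    ∑ I ∈ below F J, f I
      = f J + (∑ I ∈ below F J.left, f I + ∑ I ∈ below F J.right, f I) := by
  have hd : Disjoint (below F J.left) (below F J.right) := by
    refine Finset.disjoint_left.2 fun I h₁ h₂ => ?_
    obtain ⟨x, hx⟩ := I.toSet_nonempty
    exact Set.disjoint_left.1 J.disjoint_left_right ((mem_below.1 h₁).2 hx) ((mem_below.1 h₂).2 hx)
  have hJ : J ∉ below F J.left ∪ below F J.right := by
    intro h
    rcases Finset.mem_union.1 h with h | h <;>
    · have := scale_le_of_subset (mem_below.1 h).2
      simp [left, right] at this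
  rw [← Finset.sum_union hd, ← Finset.sum_insert (f := f) hJ]
  refine Finset.sum_subset (fun I hI => ?_) fun I hI hI' => hf I fun hF => hI' ?_
  · rw [mem_below] at hI
    simp only [Finset.mem_insert, Finset.mem_union, mem_below]
    have := subset_iff.1 hI.2
    tauto
  · simp only [Finset.mem_insert, Finset.mem_union, mem_below] at hI
    rw [mem_below]
    exact ⟨hF, subset_iff.2 (by tauto)⟩

theorem below_eq_empty {F : Finset DyadicInterval} {s : ℤ} (hs : ∀ I ∈ F, s < I.scale)
    {J : DyadicInterval} (hJ : J.scale ≤ s) : below F J = ∅ := by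
  refine Finset.eq_empty_of_forall_notMem fun I hI => ?_
  rw [mem_below] at hI
  have := scale_le_of_subset hI.2
  have := hs I hI.1
  omega

/-- Induction on dyadic intervals, from small ones to large ones. -/
theorem induction_scale {p : DyadicInterval → Prop} (s : ℤ)
    (base : ∀ J : DyadicInterval, J.scale ≤ s → p J)
    (step : ∀ J : DyadicInterval, p J.left → p J.right → p J) (J : DyadicInterval) : p J := by
  have : ∀ (n : ℕ) (J : DyadicInterval), J.scale ≤ s + n → p J := by
    intro n
    induction n with
    | zero => intro J hJ; exact base J (by simpa using hJ)
    | succ n ih =>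
      intro J hJ
      push_cast at hJ
      exact step J (ih _ (by simp only [left]; omega)) (ih _ (by simp only [right]; omega))
  exact this (J.scale - s).toNat J (by omega)

/-- Induction over the dyadic intervals, starting with those too small to contain a member of
the finite family `F`. -/
theorem induction_below {p : DyadicInterval → Prop} (F : Finset DyadicInterval)
    (base : ∀ J : DyadicInterval, below F J = ∅ → p J)
    (step : ∀ J : DyadicInterval, p J.left → p J.right → p J) (J : DyadicInterval) : p J := by
  obtain ⟨s, hs⟩ := (F.image scale).bddBelow
  -- An interval of scale s may itself belong to F, so the base case starts strictly below the lower
  -- bound s.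
  refine induction_scale (s - 1) (fun J hJ => base J (below_eq_empty (fun I hI => ?_) hJ)) step J
  have : s ≤ I.scale := hs (by simpa using ⟨I, hI, rfl⟩)
  omega

/-- A finite family of dyadic intervals is covered by finitely many disjoint ones. -/
theorem exists_tops (F : Finset DyadicInterval) :
    ∃ t : DyadicInterval → DyadicInterval, (∀ I ∈ F, I.toSet ⊆ (t I).toSet) ∧
      Set.PairwiseDisjoint (F.image t : Set DyadicInterval) toSet := by
  obtain ⟨s, hs⟩ := (F.image scale).bddAbove
  -- Lift every member to the common scale s, where distinct intervals are disjoint. A single top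
  -- need not exist: no dyadic interval contains points on both sides of 0.
  refine ⟨fun I => ancestor (s - I.scale).toNat I, fun I _ => subset_ancestor _ _, ?_⟩
  intro J hJ K hK hJK
  have hsc : ∀ J ∈ F.image (fun I => ancestor (s - I.scale).toNat I), J.scale = s := by
    intro J hJ
    obtain ⟨I, hI, rfl⟩ := Finset.mem_image.1 hJ
    have : I.scale ≤ s := hs (by simpa using ⟨I, hI, rfl⟩)
    rw [scale_ancestor]; omega
  refine Set.disjoint_left.2 fun x hx hx' => hJK (eq_of_scale_eq ?_ hx hx')
  rw [hsc J hJ, hsc K hK]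

end DyadicInterval

/-! ### Real inequalities for the Bellman induction. -/

/-- The product rule for three averages, with the error controlled by variances. -/
theorem average_product_le {s₁ s₂ u₁ u₂ m₁ m₂ n₁ n₂ p₁ p₂ q₁ q₂ m n p q l₁ l₂ : ℝ}
    (hs₁ : 0 ≤ s₁) (hs₂ : 0 ≤ s₂) (hu₁ : 0 ≤ u₁) (hu₂ : 0 ≤ u₂)
    (hp₁ : p₁ * s₁ = l₁) (hp₂ : p₂ * s₂ = l₂) (hq₁ : q₁ * u₁ = l₁) (hq₂ : q₂ * u₂ = l₂)
    (hl₁ : l₁ ^ 2 ≤ s₁ * u₁) (hl₂ : l₂ ^ 2 ≤ s₂ * u₂)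
    (hm : m * (s₁ + s₂) = m₁ * s₁ + m₂ * s₂) (hn : n * (u₁ + u₂) = n₁ * u₁ + n₂ * u₂)
    (hp : p * (s₁ + s₂) = l₁ + l₂) (hq : q * (u₁ + u₂) = l₁ + l₂) :
    m₁ * n₁ * l₁ + m₂ * n₂ * l₂ - m * n * (l₁ + l₂) ≤
      (m₁ ^ 2 * s₁ + m₂ ^ 2 * s₂ - m ^ 2 * (s₁ + s₂)) +
      (n₁ ^ 2 * u₁ + n₂ ^ 2 * u₂ - n ^ 2 * (u₁ + u₂)) +
      n ^ 2 / 2 * (p₁ ^ 2 * s₁ + p₂ ^ 2 * s₂ - p ^ 2 * (s₁ + s₂)) +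
      m ^ 2 / 2 * (q₁ ^ 2 * u₁ + q₂ ^ 2 * u₂ - q ^ 2 * (u₁ + u₂)) := by
  have key : ∀ {s u l : ℝ}, 0 ≤ s → 0 ≤ u → l ^ 2 ≤ s * u → ∀ a b : ℝ,
      2 * (l * (a * b)) ≤ s * a ^ 2 + u * b ^ 2 := by
    intro s u l hs hu hl a b
    refine (abs_le_of_sq_le_sq' ?_ (by positivity)).2
    linarith [sq_nonneg (s * a ^ 2 - u * b ^ 2), mul_le_mul_of_nonneg_right hl (sq_nonneg (a * b))]
  have var : ∀ {s₁ s₂ a₁ a₂ a : ℝ}, a * (s₁ + s₂) = a₁ * s₁ + a₂ * s₂ →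
      a₁ ^ 2 * s₁ + a₂ ^ 2 * s₂ - a ^ 2 * (s₁ + s₂) = s₁ * (a₁ - a) ^ 2 + s₂ * (a₂ - a) ^ 2 := by
    intro s₁ s₂ a₁ a₂ a h
    linear_combination (-2 * a) * h
  have hp' : p * (s₁ + s₂) = p₁ * s₁ + p₂ * s₂ := by rw [hp, hp₁, hp₂]
  have hq' : q * (u₁ + u₂) = q₁ * u₁ + q₂ * u₂ := by rw [hq, hq₁, hq₂]
  rw [var hm, var hn, var hp', var hq']
  have k₁ := key hs₁ hu₁ hl₁ (m₁ - m) (n₁ - n)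
  have k₂ := key hs₂ hu₂ hl₂ (m₂ - m) (n₂ - n)
  -- AM–GM for the two linear error terms of the identity below; half of each variance of m and n is
  -- spent here, the other half in `k₁` and `k₂`.
  have e₁ := mul_nonneg hs₁ (sq_nonneg ((m₁ - m) - n * (p₁ - p)))
  have e₂ := mul_nonneg hs₂ (sq_nonneg ((m₂ - m) - n * (p₂ - p)))
  have e₃ := mul_nonneg hu₁ (sq_nonneg ((n₁ - n) - m * (q₁ - q)))
  have e₄ := mul_nonneg hu₂ (sq_nonneg ((n₂ - n) - m * (q₂ - q)))
  -- Expand around the means m, n. The terms linear in the deviations of m are weighted by l_i = p_i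
  -- s_i, and p_i may be replaced by p_i − p because the s-weighted deviations of m sum to zero;
  -- likewise for n and q.
  have id : m₁ * n₁ * l₁ + m₂ * n₂ * l₂ - m * n * (l₁ + l₂) =
      l₁ * ((m₁ - m) * (n₁ - n)) + l₂ * ((m₂ - m) * (n₂ - n)) +
      n * (s₁ * ((m₁ - m) * (p₁ - p)) + s₂ * ((m₂ - m) * (p₂ - p))) +
      m * (u₁ * ((n₁ - n) * (q₁ - q)) + u₂ * ((n₂ - n) * (q₂ - q))) := by
    linear_combination (-n * (m₁ - m)) * hp₁ + (-n * (m₂ - m)) * hp₂ + (-m * (n₁ - n)) * hq₁ +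
      (-m * (n₂ - n)) * hq₂ - n * p * hm - m * q * hn
  rw [id]
  linarith

/-- One step of the Carleson embedding theorem: `c = x / (s + V)` with `V ≤ s`. -/
theorem carleson_step {x₁ x₂ q₁ q₂ c₁ c₂ c m s D : ℝ} (hq₁ : 0 ≤ q₁) (hq₂ : 0 ≤ q₂) (hD : 0 ≤ D)
    (h₁ : c₁ * q₁ = x₁) (h₂ : c₂ * q₂ = x₂) (h : c * (q₁ + q₂ + D) = x₁ + x₂)
    (hm : m * s = x₁ + x₂) (hm₀ : 0 ≤ m) (hc : m / 2 ≤ c) :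
    c * (x₁ + x₂) + m ^ 2 / 4 * D ≤ c₁ * x₁ + c₂ * x₂ := by
  have e₁ := mul_nonneg hq₁ (sq_nonneg (c₁ - c))
  have e₂ := mul_nonneg hq₂ (sq_nonneg (c₂ - c))
  -- The growth D of the denominator lowers the convex quantity x²/(s + V) by at least c²D, and c ≥
  -- m/2.
  have e₃ : m ^ 2 / 4 * D ≤ c ^ 2 * D := by
    refine mul_le_mul_of_nonneg_right ?_ hD
    nlinarith
  subst h₁ h₂
  have e₄ : c * (c * (q₁ + q₂ + D)) = c * (c₁ * q₁ + c₂ * q₂) := by rw [h]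
  linarith

/-- This is the variance between the two halves of the means l_i/u_i with masses u_i. The
implications make the convention l/0 = 0 harmless. -/
theorem ratio_sq_sum_nonneg {u₁ u₂ l₁ l₂ : ℝ} (hu₁ : 0 ≤ u₁) (hu₂ : 0 ≤ u₂)
    (h₁ : u₁ = 0 → l₁ = 0) (h₂ : u₂ = 0 → l₂ = 0) (h : u₁ + u₂ = 0 → l₁ + l₂ = 0) :
    0 ≤ (l₁ / u₁) ^ 2 * u₁ + (l₂ / u₂) ^ 2 * u₂ -
      ((l₁ + l₂) / (u₁ + u₂)) ^ 2 * (u₁ + u₂) := by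
  have e₁ := div_mul_cancel_of_imp h₁
  have e₂ := div_mul_cancel_of_imp h₂
  have e := div_mul_cancel_of_imp h
  generalize l₁ / u₁ = q₁ at *
  generalize l₂ / u₂ = q₂ at *
  generalize (l₁ + l₂) / (u₁ + u₂) = q at *
  have k₁ := mul_nonneg hu₁ (sq_nonneg (q₁ - q))
  have k₂ := mul_nonneg hu₂ (sq_nonneg (q₂ - q))
  have k : q * (q * (u₁ + u₂)) = q * (q₁ * u₁ + q₂ * u₂) := by rw [e, e₁, e₂]
  linarith

/-- Adding a constant to a function does not change its variance. -/
theorem variance_step {u₁ u₂ l l₁ l₂ M M₁ M₂ b : ℝ} (h : u₁ + u₂ = 0 → l₁ + l₂ = 0)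
    (hl : l = b * (u₁ + u₂) + (l₁ + l₂))
    (hM : M = M₁ + M₂ + 2 * b * (l₁ + l₂) + b ^ 2 * (u₁ + u₂)) :
    M - (l / (u₁ + u₂)) ^ 2 * (u₁ + u₂) =
      (M₁ - (l₁ / u₁) ^ 2 * u₁) + (M₂ - (l₂ / u₂) ^ 2 * u₂) +
      ((l₁ / u₁) ^ 2 * u₁ + (l₂ / u₂) ^ 2 * u₂ -
        ((l₁ + l₂) / (u₁ + u₂)) ^ 2 * (u₁ + u₂)) := by
  have : l / (u₁ + u₂) * (u₁ + u₂) = l := div_mul_cancel_of_imp fun h0 => by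
    rw [hl, h h0, h0]; ring
  have e := div_mul_cancel_of_imp h
  have k : (l / (u₁ + u₂)) ^ 2 * (u₁ + u₂) =
      b ^ 2 * (u₁ + u₂) + 2 * b * (l₁ + l₂) + ((l₁ + l₂) / (u₁ + u₂)) ^ 2 * (u₁ + u₂) := by
    rcases eq_or_ne (u₁ + u₂) 0 with h0 | h0
    · rw [h0, h h0]; ring
    · rw [hl]; field_simp; ring
  rw [k, hM]; ring

open DyadicInterval in
/-- The bilinear bound on the dyadic tree: if `M` and `N` are the localized testing quantities
and are at most `s` and `u`, then the bilinear sum `S` is at most `3 (X + Y)`. -/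
theorem tree_bound (F : Finset DyadicInterval) {a s u x y X Y L M N S : DyadicInterval → ℝ}
    (ha : ∀ J, 0 ≤ a J) (hs₀ : ∀ J, 0 ≤ s J) (hu₀ : ∀ J, 0 ≤ u J) (hx₀ : ∀ J, 0 ≤ x J)
    (hy₀ : ∀ J, 0 ≤ y J)
    (hs : ∀ J, s J = s J.left + s J.right) (hu : ∀ J, u J = u J.left + u J.right)
    (hx : ∀ J, x J = x J.left + x J.right) (hy : ∀ J, y J = y J.left + y J.right)
    (hX : ∀ J, X J = X J.left + X J.right) (hY : ∀ J, Y J = Y J.left + Y J.right)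
    (hxX : ∀ J, x J ^ 2 ≤ s J * X J) (hyY : ∀ J, y J ^ 2 ≤ u J * Y J)
    (hX₀ : ∀ J, 0 ≤ X J) (hY₀ : ∀ J, 0 ≤ Y J)
    (hL : ∀ J, L J = a J * s J * u J + (L J.left + L J.right))
    (hM : ∀ J, M J = M J.left + M J.right + 2 * (a J * s J) * (L J.left + L J.right)
      + (a J * s J) ^ 2 * u J)
    (hN : ∀ J, N J = N J.left + N J.right + 2 * (a J * u J) * (L J.left + L J.right)
      + (a J * u J) ^ 2 * s J)
    (hS : ∀ J, S J = a J * x J * y J + (S J.left + S J.right))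
    (hbase : ∀ J, below F J = ∅ → L J = 0 ∧ M J = 0 ∧ N J = 0 ∧ S J = 0)
    (hMs : ∀ J, M J ≤ s J) (hNu : ∀ J, N J ≤ u J) (J : DyadicInterval) :
    S J ≤ 3 * (X J + Y J) := by
  have zero_of_sq : ∀ {p q r : ℝ}, p ^ 2 ≤ q * r → q = 0 → p = 0 := fun {p q r} h h0 => by
    rw [h0, zero_mul] at h
    exact (pow_eq_zero_iff two_ne_zero).1 (le_antisymm h (sq_nonneg _))
  have hmx : ∀ J, x J / s J * s J = x J := fun J => div_mul_cancel_of_imp (zero_of_sq (hxX J))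
  have hny : ∀ J, y J / u J * u J = y J := fun J => div_mul_cancel_of_imp (zero_of_sq (hyY J))
  have le_energy : ∀ {p q r : ℝ}, 0 ≤ q → 0 ≤ r → p ^ 2 ≤ q * r → p / q * p ≤ r := by
    intro p q r hq hr h
    rcases hq.eq_or_lt with h0 | h0
    · rw [← h0]; simpa using hr
    · rw [div_mul_eq_mul_div, div_le_iff₀ h0]; linarith
  -- The claims need one joint induction: nonnegative variance together with M ≤ s gives L² ≤ su,
  -- and this forces L to vanish with s or u, which the variance recursion needs one level up.
  have hLV : ∀ J, 0 ≤ L J ∧ L J ^ 2 ≤ s J * u J ∧ 0 ≤ M J - (L J / u J) ^ 2 * u J ∧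
      0 ≤ N J - (L J / s J) ^ 2 * s J := by
    refine induction_below F (fun J hJ => ?_) fun J h₁ h₂ => ?_
    · obtain ⟨h1, h2, h3, -⟩ := hbase J hJ
      rw [h1, h2, h3]
      simpa using mul_nonneg (hs₀ J) (hu₀ J)
    · have zs₁ := zero_of_sq h₁.2.1
      have zs₂ := zero_of_sq h₂.2.1
      have zu₁ := zero_of_sq (h₁.2.1.trans_eq (mul_comm _ _))
      have zu₂ := zero_of_sq (h₂.2.1.trans_eq (mul_comm _ _))
      have zs : s J.left + s J.right = 0 → L J.left + L J.right = 0 := fun h => by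
        rw [zs₁ (by linarith [hs₀ J.left, hs₀ J.right]),
          zs₂ (by linarith [hs₀ J.left, hs₀ J.right]), add_zero]
      have zu : u J.left + u J.right = 0 → L J.left + L J.right = 0 := fun h => by
        rw [zu₁ (by linarith [hu₀ J.left, hu₀ J.right]),
          zu₂ (by linarith [hu₀ J.left, hu₀ J.right]), add_zero]
      have hV : 0 ≤ M J - (L J / u J) ^ 2 * u J := by
        rw [hu J, variance_step zu (by rw [hL J, hu J]) (by rw [hM J, hu J])]
        linarith [ratio_sq_sum_nonneg (hu₀ _) (hu₀ _) zu₁ zu₂ zu, h₁.2.2.1, h₂.2.2.1]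
      have hW : 0 ≤ N J - (L J / s J) ^ 2 * s J := by
        rw [hs J, variance_step (b := a J * u J) zs (by rw [hL J, hs J]; ring) (by rw [hN J, hs J])]
        linarith [ratio_sq_sum_nonneg (hs₀ _) (hs₀ _) zs₁ zs₂ zs, h₁.2.2.2, h₂.2.2.2]
      refine ⟨?_, ?_, hV, hW⟩
      · rw [hL J]
        have := mul_nonneg (mul_nonneg (ha J) (hs₀ J)) (hu₀ J)
        linarith [h₁.1, h₂.1]
      · rcases (hu₀ J).eq_or_lt with h0 | h0
        · rw [hL J, zu (by rw [← hu J, ← h0]), ← h0]; simp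
        · have : (L J / u J) ^ 2 * u J ≤ s J := by linarith [hMs J]
          have h2 : (L J / u J) ^ 2 * u J * u J = L J ^ 2 := by field_simp
          rw [← h2]
          exact mul_le_mul_of_nonneg_right this h0.le
  have hL₀ := fun J => (hLV J).1
  have hLsu := fun J => (hLV J).2.1
  have hV₀ := fun J => (hLV J).2.2.1
  have hW₀ := fun J => (hLV J).2.2.2
  have zs := fun J => zero_of_sq (hLsu J)
  have zu := fun J => zero_of_sq ((hLsu J).trans_eq (mul_comm _ _))
  have zs' : ∀ J : DyadicInterval, s J.left + s J.right = 0 → L J.left + L J.right = 0 := fun J h => by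
    rw [zs _ (by linarith [hs₀ J.left, hs₀ J.right]),
      zs _ (by linarith [hs₀ J.left, hs₀ J.right]), add_zero]
  have zu' : ∀ J : DyadicInterval, u J.left + u J.right = 0 → L J.left + L J.right = 0 := fun J h => by
    rw [zu _ (by linarith [hu₀ J.left, hu₀ J.right]),
      zu _ (by linarith [hu₀ J.left, hu₀ J.right]), add_zero]
  -- Applied with r = V ≤ s = q: the Carleson term keeps at least half of the average x/s.
  have half_le : ∀ {p q r : ℝ}, 0 ≤ p → 0 ≤ q → 0 ≤ r → r ≤ q → p / q / 2 ≤ p / (q + r) := by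
    intro p q r hp hq hr hrq
    rcases hq.eq_or_lt with h0 | h0
    · rw [← h0]; simp only [div_zero, zero_div, zero_add]; positivity
    · rw [div_div]
      exact div_le_div_of_nonneg_left hp (by linarith) (by linarith)
  set V : DyadicInterval → ℝ := fun J => M J - (L J / u J) ^ 2 * u J with hVdef
  set W : DyadicInterval → ℝ := fun J => N J - (L J / s J) ^ 2 * s J with hWdef
  have hVs : ∀ J, V J ≤ s J := fun J => by
    have := mul_nonneg (sq_nonneg (L J / u J)) (hu₀ J)
    simp only [hVdef]; linarith [hMs J]
  have hWu : ∀ J, W J ≤ u J := fun J => by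
    have := mul_nonneg (sq_nonneg (L J / s J)) (hs₀ J)
    simp only [hWdef]; linarith [hNu J]
  have hcx : ∀ J, x J / (s J + V J) * (s J + V J) = x J := fun J => div_mul_cancel_of_imp fun h =>
    zero_of_sq (hxX J) (by linarith [hs₀ J, hV₀ J])
  have hdy : ∀ J, y J / (u J + W J) * (u J + W J) = y J := fun J => div_mul_cancel_of_imp fun h =>
    zero_of_sq (hyY J) (by linarith [hu₀ J, hW₀ J])
  -- The Bellman potential. The factor 2 matches the gain m²D/4 of `carleson_step` to the loss m²D/2
  -- of `average_product_le`.
  have main : ∀ J, S J + x J / s J * x J + y J / u J * y J + 2 * (x J / (s J + V J) * x J) +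
      2 * (y J / (u J + W J) * y J) - x J / s J * (y J / u J) * L J ≤ 3 * (X J + Y J) := by
    refine induction_below F (fun J hJ => ?_) fun J h₁ h₂ => ?_
    -- Without members of F below J one has V = W = L = S = 0, so x²/s and y²/u each occur 1 + 2 = 3
    -- times: the origin of the constant 3.
    · obtain ⟨h1, h2, h3, h4⟩ := hbase J hJ
      have hV : V J = 0 := by simp only [hVdef]; rw [h1, h2]; simp
      have hW : W J = 0 := by simp only [hWdef]; rw [h1, h3]; simp
      rw [hV, hW, h1, h4]
      simp only [add_zero, mul_zero]
      linarith [le_energy (hs₀ J) (hX₀ J) (hxX J), le_energy (hu₀ J) (hY₀ J) (hyY J)]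
    · have hVJ := variance_step (l := L J) (M := M J) (M₁ := M J.left) (M₂ := M J.right)
        (b := a J * s J) (zu' J) (by rw [hL J, hu J]) (by rw [hM J, hu J])
      have hWJ := variance_step (l := L J) (M := N J) (M₁ := N J.left) (M₂ := N J.right)
        (b := a J * u J) (zs' J) (by rw [hL J, hs J]; ring)
        (by rw [hN J, hs J])
      have hD := ratio_sq_sum_nonneg (hu₀ _) (hu₀ _) (zu J.left) (zu J.right) (zu' J)
      have hE := ratio_sq_sum_nonneg (hs₀ _) (hs₀ _) (zs J.left) (zs J.right) (zs' J)
      have hm₀ : ∀ J, 0 ≤ x J / s J := fun J => div_nonneg (hx₀ J) (hs₀ J)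
      have hn₀ : ∀ J, 0 ≤ y J / u J := fun J => div_nonneg (hy₀ J) (hu₀ J)
      have avg := average_product_le (hs₀ J.left) (hs₀ J.right) (hu₀ J.left) (hu₀ J.right)
        (div_mul_cancel_of_imp (zs J.left)) (div_mul_cancel_of_imp (zs J.right))
        (div_mul_cancel_of_imp (zu J.left)) (div_mul_cancel_of_imp (zu J.right))
        (hLsu J.left) (hLsu J.right) (m := x J / s J) (n := y J / u J)
        (by rw [← hs J, hmx, hmx, hmx, hx J]) (by rw [← hu J, hny, hny, hny, hy J])
        (div_mul_cancel_of_imp (zs' J)) (div_mul_cancel_of_imp (zu' J))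
      -- D is the variance of the two means L/u. By `hVJ`, s + V at J is the sum of the values of s
      -- + V on the halves, plus D.
      have car₁ := carleson_step (add_nonneg (hs₀ J.left) (hV₀ J.left))
        (add_nonneg (hs₀ J.right) (hV₀ J.right)) hD (hcx J.left) (hcx J.right)
        (c := x J / (s J + V J)) (m := x J / s J)
        (by rw [← hx J]; convert hcx J using 2
            simp only [hVdef]; rw [hs J, hu J, hVJ]; ring)
        (by rw [hmx, hx J]) (hm₀ J) (half_le (hx₀ J) (hs₀ J) (hV₀ J) (hVs J))
      have car₂ := carleson_step (add_nonneg (hu₀ J.left) (hW₀ J.left))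
        (add_nonneg (hu₀ J.right) (hW₀ J.right)) hE (hdy J.left) (hdy J.right)
        (c := y J / (u J + W J)) (m := y J / u J)
        (by rw [← hy J]; convert hdy J using 2
            simp only [hWdef]; rw [hs J, hu J, hWJ]; ring)
        (by rw [hny, hy J]) (hn₀ J) (half_le (hy₀ J) (hu₀ J) (hW₀ J) (hWu J))
      have sq_mul : ∀ {p q r : ℝ}, p * q = r → p ^ 2 * q = p * r := fun {p q r} h => by
        rw [← h]; ring
      -- The part of mnL coming from J itself is a·x·y, exactly the new term of S, so the two
      -- cancel.
      have hxyJ : x J / s J * (y J / u J) * L J =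
          a J * x J * y J + x J / s J * (y J / u J) * (L J.left + L J.right) := by
        calc _ = a J * (x J / s J * s J) * (y J / u J * u J) +
              x J / s J * (y J / u J) * (L J.left + L J.right) := by rw [hL J]; ring
          _ = _ := by rw [hmx, hny]
      rw [sq_mul (hmx J.left), sq_mul (hmx J.right), sq_mul (hny J.left), sq_mul (hny J.right),
        ← hs J, ← hu J, sq_mul (hmx J), sq_mul (hny J)] at avg
      rw [← hx J, ← hu J] at car₁
      rw [← hy J, ← hs J] at car₂
      rw [hxyJ, hS J, hX J, hY J]
      linarith
  -- Since L² ≤ su, the negative term mnL is dominated by x²/s + y²/u, so the potential controls S.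
  have hfin : 2 * (L J * (x J / s J * (y J / u J))) ≤ x J / s J * x J + y J / u J * y J := by
    refine (abs_le_of_sq_le_sq' ?_ ?_).2
    · have e₁ : x J / s J * x J = s J * (x J / s J) ^ 2 := by
        nth_rw 2 [← hmx J]; ring
      have e₂ : y J / u J * y J = u J * (y J / u J) ^ 2 := by
        nth_rw 2 [← hny J]; ring
      rw [e₁, e₂]
      linarith [sq_nonneg (s J * (x J / s J) ^ 2 - u J * (y J / u J) ^ 2),
        mul_le_mul_of_nonneg_right (hLsu J) (sq_nonneg (x J / s J * (y J / u J)))]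
    · have := hx₀ J; have := hy₀ J; have := hs₀ J; have := hu₀ J; positivity
  have p₁ : 0 ≤ x J / (s J + V J) * x J :=
    mul_nonneg (div_nonneg (hx₀ J) (add_nonneg (hs₀ J) (hV₀ J))) (hx₀ J)
  have p₂ : 0 ≤ y J / (u J + W J) * y J :=
    mul_nonneg (div_nonneg (hy₀ J) (add_nonneg (hu₀ J) (hW₀ J))) (hy₀ J)
  have p₃ : 0 ≤ x J / s J * x J := mul_nonneg (div_nonneg (hx₀ J) (hs₀ J)) (hx₀ J)
  have p₄ : 0 ≤ y J / u J * y J := mul_nonneg (div_nonneg (hy₀ J) (hu₀ J)) (hy₀ J)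
  linarith [main J]

/-! ### Local sums of the operator, and the tree bound for measures. -/

theorem lintegral_toSet_eq_add (μ : Measure ℝ) (f : ℝ → ℝ≥0∞) (J : DyadicInterval) :
    ∫⁻ x in J.toSet, f x ∂μ = ∫⁻ x in J.left.toSet, f x ∂μ + ∫⁻ x in J.right.toSet, f x ∂μ := by
  rw [← J.left_union_right, lintegral_union J.right.measurableSet_toSet J.disjoint_left_right]

theorem measure_toSet_eq_add (μ : Measure ℝ) (J : DyadicInterval) :
    μ J.toSet = μ J.left.toSet + μ J.right.toSet := by
  rw [← J.left_union_right, measure_union J.disjoint_left_right J.right.measurableSet_toSet]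

/-- The part of the operator with coefficients `a`, applied to the measure `σ`, that comes from
the members of `F` in `J`. -/
def localSum (F : Finset DyadicInterval) (a : DyadicInterval → ℝ≥0) (σ : Measure ℝ)
    (J : DyadicInterval) (x : ℝ) : ℝ≥0∞ :=
  ∑ I ∈ below F J, a I * σ I.toSet * I.toSet.indicator 1 x

@[fun_prop]
theorem measurable_localSum (F : Finset DyadicInterval) (a : DyadicInterval → ℝ≥0)
    (σ : Measure ℝ) (J : DyadicInterval) : Measurable (localSum F a σ J) := by
  unfold localSum
  refine Finset.measurable_fun_sum _ fun I _ => ?_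
  exact (measurable_one.indicator I.measurableSet_toSet).const_mul _

section

variable {F : Finset DyadicInterval} {a : DyadicInterval → ℝ≥0}

theorem localSum_eq_zero {σ : Measure ℝ} {J : DyadicInterval} {x : ℝ} (hx : x ∉ J.toSet) :
    localSum F a σ J x = 0 := by
  refine Finset.sum_eq_zero fun I hI => ?_
  rw [Set.indicator_of_notMem fun h => hx ((mem_below.1 hI).2 h), mul_zero]

theorem localSum_of_mem (ha : ∀ I, I ∉ F → a I = 0) {σ : Measure ℝ} {J : DyadicInterval} {x : ℝ}
    (hx : x ∈ J.toSet) :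
    localSum F a σ J x
      = a J * σ J.toSet + (localSum F a σ J.left x + localSum F a σ J.right x) := by
  have := sum_below F (fun I => a I * σ I.toSet * I.toSet.indicator 1 x)
    (fun I hI => by simp [ha I hI]) J
  simpa [localSum, hx] using this

theorem localSum_of_mem_left (ha : ∀ I, I ∉ F → a I = 0) {σ : Measure ℝ} {J : DyadicInterval}
    {x : ℝ} (hx : x ∈ J.left.toSet) :
    localSum F a σ J x = a J * σ J.toSet + localSum F a σ J.left x := by
  rw [localSum_of_mem ha (J.left_subset hx),
    localSum_eq_zero (Set.disjoint_left.1 J.disjoint_left_right hx), add_zero]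

theorem localSum_of_mem_right (ha : ∀ I, I ∉ F → a I = 0) {σ : Measure ℝ} {J : DyadicInterval}
    {x : ℝ} (hx : x ∈ J.right.toSet) :
    localSum F a σ J x = a J * σ J.toSet + localSum F a σ J.right x := by
  rw [localSum_of_mem ha (J.right_subset hx),
    localSum_eq_zero (Set.disjoint_right.1 J.disjoint_left_right hx), zero_add]

theorem lintegral_localSum (σ μ : Measure ℝ) (J : DyadicInterval) :
    ∫⁻ x in J.toSet, localSum F a σ J x ∂μ =
      ∑ I ∈ below F J, a I * σ I.toSet * μ I.toSet := by
  have hm : ∀ I : DyadicInterval, Measurable (I.toSet.indicator (1 : ℝ → ℝ≥0∞)) := fun I =>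
    measurable_one.indicator I.measurableSet_toSet
  unfold localSum
  rw [lintegral_finsetSum _ fun I _ => (hm I).const_mul _]
  refine Finset.sum_congr rfl fun I hI => ?_
  rw [lintegral_const_mul _ (hm I), lintegral_indicator_one I.measurableSet_toSet,
    Measure.restrict_apply I.measurableSet_toSet, Set.inter_eq_left.2 (mem_below.1 hI).2]

theorem lintegral_sq_const_add (μ : Measure ℝ) (c : ℝ≥0∞) {f : ℝ → ℝ≥0∞} (hf : Measurable f)
    (s : Set ℝ) : ∫⁻ x in s, (c + f x) ^ 2 ∂μ =
      c ^ 2 * μ s + 2 * c * ∫⁻ x in s, f x ∂μ + ∫⁻ x in s, f x ^ 2 ∂μ := by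
  rw [← lintegral_const_mul _ hf, ← setLIntegral_const, ← lintegral_add_left measurable_const,
    ← lintegral_add_left (by fun_prop)]
  exact lintegral_congr fun x => by ring

/-- On each half of J the local sum is the constant a_J σ(J) plus the local sum of that half; expand
the square. This is the recursion for M and N in `tree_bound`. -/
theorem lintegral_localSum_sq (ha : ∀ I, I ∉ F → a I = 0) (σ μ : Measure ℝ) (J : DyadicInterval) :
    ∫⁻ x in J.toSet, localSum F a σ J x ^ 2 ∂μ =
      ∫⁻ x in J.left.toSet, localSum F a σ J.left x ^ 2 ∂μ +
      ∫⁻ x in J.right.toSet, localSum F a σ J.right x ^ 2 ∂μ +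
      2 * (a J * σ J.toSet) * (∑ I ∈ below F J.left, a I * σ I.toSet * μ I.toSet +
        ∑ I ∈ below F J.right, a I * σ I.toSet * μ I.toSet) +
      (a J * σ J.toSet) ^ 2 * μ J.toSet := by
  rw [lintegral_toSet_eq_add,
    setLIntegral_congr_fun (g := fun x => (a J * σ J.toSet + localSum F a σ J.left x) ^ 2)
      J.left.measurableSet_toSet fun x hx => by simp only [localSum_of_mem_left ha hx],
    setLIntegral_congr_fun (g := fun x => (a J * σ J.toSet + localSum F a σ J.right x) ^ 2)
      J.right.measurableSet_toSet fun x hx => by simp only [localSum_of_mem_right ha hx],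
    lintegral_sq_const_add _ _ (by fun_prop), lintegral_sq_const_add _ _ (by fun_prop),
    lintegral_localSum, lintegral_localSum, measure_toSet_eq_add μ J]
  ring

end

/-- The Cauchy–Schwarz inequality. -/
theorem lintegral_mul_sq_le (μ : Measure ℝ) {f g : ℝ → ℝ≥0∞} (hf : AEMeasurable f μ)
    (hg : AEMeasurable g μ) :
    (∫⁻ x, f x * g x ∂μ) ^ 2 ≤ (∫⁻ x, f x ^ 2 ∂μ) * ∫⁻ x, g x ^ 2 ∂μ := by
  have h := ENNReal.lintegral_mul_le_Lp_mul_Lq μ Real.HolderConjugate.two_two hf hg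
  have h2 := pow_le_pow_left' h 2
  simp only [Pi.mul_apply] at h2
  refine h2.trans_eq ?_
  rw [mul_pow, ← ENNReal.rpow_natCast, ← ENNReal.rpow_natCast, ← ENNReal.rpow_mul,
    ← ENNReal.rpow_mul]
  norm_num

theorem setLIntegral_sq_le (μ : Measure ℝ) {f : ℝ → ℝ≥0∞} (hf : Measurable f) (s : Set ℝ) :
    (∫⁻ x in s, f x ∂μ) ^ 2 ≤ μ s * ∫⁻ x in s, f x ^ 2 ∂μ := by
  have := lintegral_mul_sq_le (μ.restrict s) (f := fun _ => 1) (g := f) (by fun_prop)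
    hf.aemeasurable
  simpa using this

theorem setLIntegral_ne_top_of_sq {μ : Measure ℝ} {φ : ℝ → ℝ≥0∞} (hφ : Measurable φ)
    (hμ : ∀ I : DyadicInterval, μ I.toSet ≠ ∞) (h : ∫⁻ x, φ x ^ 2 ∂μ ≠ ∞) (I : DyadicInterval) :
    ∫⁻ x in I.toSet, φ x ∂μ ≠ ∞ := fun hI => by
  have := setLIntegral_sq_le μ hφ I.toSet
  rw [hI] at this
  exact ENNReal.mul_ne_top (hμ I) (ne_top_of_le_ne_top h (setLIntegral_le_lintegral _ _))
    (top_le_iff.1 (by simpa using this))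

/-- The bilinear form over the members of `F` in a fixed dyadic interval. -/
theorem sum_below_bilinear_le {F : Finset DyadicInterval} {a : DyadicInterval → ℝ≥0}
    (ha : ∀ I, I ∉ F → a I = 0) {σ μ : Measure ℝ} (hσ : ∀ J : DyadicInterval, σ J.toSet ≠ ∞)
    (hμ : ∀ J : DyadicInterval, μ J.toSet ≠ ∞)
    (h₁ : ∀ J : DyadicInterval, ∫⁻ x in J.toSet, localSum F a σ J x ^ 2 ∂μ ≤ σ J.toSet)
    (h₂ : ∀ J : DyadicInterval, ∫⁻ x in J.toSet, localSum F a μ J x ^ 2 ∂σ ≤ μ J.toSet)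
    {φ ψ : ℝ → ℝ≥0∞} (hφ : Measurable φ) (hψ : Measurable ψ)
    (hφ₂ : ∫⁻ x, φ x ^ 2 ∂σ ≠ ∞) (hψ₂ : ∫⁻ x, ψ x ^ 2 ∂μ ≠ ∞) (J : DyadicInterval) :
    ∑ I ∈ below F J, a I * (∫⁻ x in I.toSet, φ x ∂σ) * (∫⁻ x in I.toSet, ψ x ∂μ) ≤
      3 * (∫⁻ x in J.toSet, φ x ^ 2 ∂σ + ∫⁻ x in J.toSet, ψ x ^ 2 ∂μ) := by
  have fX : ∀ J : DyadicInterval, ∫⁻ x in J.toSet, φ x ^ 2 ∂σ ≠ ∞ := fun J =>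
    ne_top_of_le_ne_top hφ₂ (setLIntegral_le_lintegral _ _)
  have fY : ∀ J : DyadicInterval, ∫⁻ x in J.toSet, ψ x ^ 2 ∂μ ≠ ∞ := fun J =>
    ne_top_of_le_ne_top hψ₂ (setLIntegral_le_lintegral _ _)
  have fx := setLIntegral_ne_top_of_sq hφ hσ hφ₂
  have fy := setLIntegral_ne_top_of_sq hψ hμ hψ₂
  have fM : ∀ J : DyadicInterval, ∫⁻ x in J.toSet, localSum F a σ J x ^ 2 ∂μ ≠ ∞ := fun J =>
    ne_top_of_le_ne_top (hσ J) (h₁ J)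
  have fN : ∀ J : DyadicInterval, ∫⁻ x in J.toSet, localSum F a μ J x ^ 2 ∂σ ≠ ∞ := fun J =>
    ne_top_of_le_ne_top (hμ J) (h₂ J)
  have fL : ∀ J : DyadicInterval, ∑ I ∈ below F J, a I * σ I.toSet * μ I.toSet ≠ ∞ := fun J =>
    ENNReal.sum_ne_top.2 fun I _ =>
      ENNReal.mul_ne_top (ENNReal.mul_ne_top ENNReal.coe_ne_top (hσ I)) (hμ I)
  have fS : ∀ J : DyadicInterval, ∑ I ∈ below F J,
      a I * (∫⁻ x in I.toSet, φ x ∂σ) * (∫⁻ x in I.toSet, ψ x ∂μ) ≠ ∞ := fun J =>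
    ENNReal.sum_ne_top.2 fun I _ =>
      ENNReal.mul_ne_top (ENNReal.mul_ne_top ENNReal.coe_ne_top (fx I)) (fy I)
  have comm : ∀ J : DyadicInterval, ∑ I ∈ below F J, (a I : ℝ≥0∞) * μ I.toSet * σ I.toSet =
      ∑ I ∈ below F J, a I * σ I.toSet * μ I.toSet := fun J =>
    Finset.sum_congr rfl fun I _ => by ring
  have key := tree_bound F (a := fun J => (a J : ℝ)) (s := fun J => (σ J.toSet).toReal)
    (u := fun J => (μ J.toSet).toReal) (x := fun J => (∫⁻ x in J.toSet, φ x ∂σ).toReal)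
    (y := fun J => (∫⁻ x in J.toSet, ψ x ∂μ).toReal)
    (X := fun J => (∫⁻ x in J.toSet, φ x ^ 2 ∂σ).toReal)
    (Y := fun J => (∫⁻ x in J.toSet, ψ x ^ 2 ∂μ).toReal)
    (L := fun J => (∑ I ∈ below F J, a I * σ I.toSet * μ I.toSet).toReal)
    (M := fun J => (∫⁻ x in J.toSet, localSum F a σ J x ^ 2 ∂μ).toReal)
    (N := fun J => (∫⁻ x in J.toSet, localSum F a μ J x ^ 2 ∂σ).toReal)
    (S := fun J => (∑ I ∈ below F J,
      a I * (∫⁻ x in I.toSet, φ x ∂σ) * (∫⁻ x in I.toSet, ψ x ∂μ)).toReal)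
    (fun J => (a J).2) (fun _ => ENNReal.toReal_nonneg) (fun _ => ENNReal.toReal_nonneg)
    (fun _ => ENNReal.toReal_nonneg) (fun _ => ENNReal.toReal_nonneg)
    (fun J => by rw [measure_toSet_eq_add, ENNReal.toReal_add (hσ _) (hσ _)])
    (fun J => by rw [measure_toSet_eq_add, ENNReal.toReal_add (hμ _) (hμ _)])
    (fun J => by rw [lintegral_toSet_eq_add, ENNReal.toReal_add (fx _) (fx _)])
    (fun J => by rw [lintegral_toSet_eq_add, ENNReal.toReal_add (fy _) (fy _)])
    (fun J => by rw [lintegral_toSet_eq_add, ENNReal.toReal_add (fX _) (fX _)])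
    (fun J => by rw [lintegral_toSet_eq_add, ENNReal.toReal_add (fY _) (fY _)])
    (fun J => by
      rw [← ENNReal.toReal_mul, ← ENNReal.toReal_pow]
      exact ENNReal.toReal_mono (ENNReal.mul_ne_top (hσ J) (fX J)) (setLIntegral_sq_le σ hφ _))
    (fun J => by
      rw [← ENNReal.toReal_mul, ← ENNReal.toReal_pow]
      exact ENNReal.toReal_mono (ENNReal.mul_ne_top (hμ J) (fY J)) (setLIntegral_sq_le μ hψ _))
    (fun _ => ENNReal.toReal_nonneg) (fun _ => ENNReal.toReal_nonneg)
    (fun J => by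
      rw [sum_below F _ (fun I hI => by simp [ha I hI]) J, ENNReal.toReal_add
        (ENNReal.mul_ne_top (ENNReal.mul_ne_top ENNReal.coe_ne_top (hσ J)) (hμ J))
        (ENNReal.add_ne_top.2 ⟨fL _, fL _⟩), ENNReal.toReal_add (fL _) (fL _)]
      simp)
    (fun J => by
      have e := lintegral_localSum_sq ha σ μ J
      have t := fM J
      rw [e] at t ⊢
      obtain ⟨t, t₄⟩ := ENNReal.add_ne_top.1 t
      obtain ⟨t, t₃⟩ := ENNReal.add_ne_top.1 t
      rw [ENNReal.toReal_add (ENNReal.add_ne_top.2 ⟨t, t₃⟩) t₄, ENNReal.toReal_add t t₃,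
        ENNReal.toReal_add (fM _) (fM _), ENNReal.toReal_mul, ENNReal.toReal_add (fL _) (fL _)]
      simp)
    (fun J => by
      have e := lintegral_localSum_sq ha μ σ J
      rw [comm, comm] at e
      have t := fN J
      rw [e] at t ⊢
      obtain ⟨t, t₄⟩ := ENNReal.add_ne_top.1 t
      obtain ⟨t, t₃⟩ := ENNReal.add_ne_top.1 t
      rw [ENNReal.toReal_add (ENNReal.add_ne_top.2 ⟨t, t₃⟩) t₄, ENNReal.toReal_add t t₃,
        ENNReal.toReal_add (fN _) (fN _), ENNReal.toReal_mul, ENNReal.toReal_add (fL _) (fL _)]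
      simp)
    (fun J => by
      rw [sum_below F _ (fun I hI => by simp [ha I hI]) J, ENNReal.toReal_add
        (ENNReal.mul_ne_top (ENNReal.mul_ne_top ENNReal.coe_ne_top (fx J)) (fy J))
        (ENNReal.add_ne_top.2 ⟨fS _, fS _⟩), ENNReal.toReal_add (fS _) (fS _)]
      simp)
    (fun J hJ => by simp [hJ, localSum])
    (fun J => ENNReal.toReal_mono (hσ J) (h₁ J)) (fun J => ENNReal.toReal_mono (hμ J) (h₂ J)) J
  have e : (3 * (∫⁻ x in J.toSet, φ x ^ 2 ∂σ + ∫⁻ x in J.toSet, ψ x ^ 2 ∂μ)).toReal =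
      3 * ((∫⁻ x in J.toSet, φ x ^ 2 ∂σ).toReal + (∫⁻ x in J.toSet, ψ x ^ 2 ∂μ).toReal) := by
    rw [ENNReal.toReal_mul, ENNReal.toReal_add (fX J) (fY J)]; simp
  rw [← e] at key
  exact (ENNReal.toReal_le_toReal (fS J) (ENNReal.mul_ne_top (by simp)
    (ENNReal.add_ne_top.2 ⟨fX J, fY J⟩))).1 key

/-! ### Operator, form and testing bounds for a pair of measures. -/

section

theorem measurable_indicator_toSet (I : DyadicInterval) :
    Measurable (I.toSet.indicator (1 : ℝ → ℝ≥0∞)) :=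
  measurable_one.indicator I.measurableSet_toSet

theorem lintegral_mul_indicator_toSet (μ : Measure ℝ) (f : ℝ → ℝ≥0∞) (I : DyadicInterval) :
    ∫⁻ x, f x * I.toSet.indicator 1 x ∂μ = ∫⁻ x in I.toSet, f x ∂μ := by
  rw [← lintegral_indicator I.measurableSet_toSet]
  refine lintegral_congr fun x => ?_
  by_cases hx : x ∈ I.toSet <;> simp [hx]

/-- The bilinear form over a finite family, under normalized testing conditions. -/
theorem sum_bilinear_le {F : Finset DyadicInterval} {a : DyadicInterval → ℝ≥0}
    (ha : ∀ I, I ∉ F → a I = 0) {σ μ : Measure ℝ} (hσ : ∀ J : DyadicInterval, σ J.toSet ≠ ∞)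
    (hμ : ∀ J : DyadicInterval, μ J.toSet ≠ ∞)
    (h₁ : ∀ J : DyadicInterval, ∫⁻ x in J.toSet, localSum F a σ J x ^ 2 ∂μ ≤ σ J.toSet)
    (h₂ : ∀ J : DyadicInterval, ∫⁻ x in J.toSet, localSum F a μ J x ^ 2 ∂σ ≤ μ J.toSet)
    {φ ψ : ℝ → ℝ≥0∞} (hφ : Measurable φ) (hψ : Measurable ψ)
    (hφ₂ : ∫⁻ x, φ x ^ 2 ∂σ ≠ ∞) (hψ₂ : ∫⁻ x, ψ x ^ 2 ∂μ ≠ ∞) :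
    ∑ I ∈ F, a I * (∫⁻ x in I.toSet, φ x ∂σ) * (∫⁻ x in I.toSet, ψ x ∂μ) ≤
      3 * (∫⁻ x, φ x ^ 2 ∂σ + ∫⁻ x, ψ x ^ 2 ∂μ) := by
  obtain ⟨t, ht, hd⟩ := exists_tops F
  have sum_le : ∀ (ρ : Measure ℝ) (f : ℝ → ℝ≥0∞),
      ∑ J ∈ F.image t, ∫⁻ x in J.toSet, f x ∂ρ ≤ ∫⁻ x, f x ∂ρ := fun ρ f => by
    rw [← lintegral_biUnion_finset hd fun J _ => J.measurableSet_toSet]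
    exact setLIntegral_le_lintegral _ _
  calc ∑ I ∈ F, a I * (∫⁻ x in I.toSet, φ x ∂σ) * (∫⁻ x in I.toSet, ψ x ∂μ)
      = ∑ J ∈ F.image t, ∑ I ∈ F with t I = J,
          a I * (∫⁻ x in I.toSet, φ x ∂σ) * (∫⁻ x in I.toSet, ψ x ∂μ) :=
        (Finset.sum_fiberwise_of_maps_to (fun I hI => Finset.mem_image_of_mem t hI) _).symm
    _ ≤ ∑ J ∈ F.image t, ∑ I ∈ below F J,
          a I * (∫⁻ x in I.toSet, φ x ∂σ) * (∫⁻ x in I.toSet, ψ x ∂μ) := by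
        refine Finset.sum_le_sum fun J _ => Finset.sum_le_sum_of_subset fun I hI => ?_
        obtain ⟨hF, rfl⟩ := Finset.mem_filter.1 hI
        exact mem_below.2 ⟨hF, ht I hF⟩
    _ ≤ ∑ J ∈ F.image t, 3 * (∫⁻ x in J.toSet, φ x ^ 2 ∂σ + ∫⁻ x in J.toSet, ψ x ^ 2 ∂μ) :=
        Finset.sum_le_sum fun J _ =>
          sum_below_bilinear_le ha hσ hμ h₁ h₂ hφ hψ hφ₂ hψ₂ J
    _ ≤ _ := by
        rw [← Finset.mul_sum, Finset.sum_add_distrib]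
        gcongr <;> exact sum_le _ _

/-- Bounds for the square of a sum of nonnegative functions follow from bounds for the finite
partial sums. -/
theorem lintegral_tsum_sq_le {ι : Type*} [Countable ι] {μ : Measure ℝ} {g : ι → ℝ → ℝ≥0∞}
    (hg : ∀ i, Measurable (g i)) {B : ℝ≥0∞}
    (h : ∀ s : Finset ι, ∫⁻ x, (∑ i ∈ s, g i x) ^ 2 ∂μ ≤ B) :
    ∫⁻ x, (∑' i, g i x) ^ 2 ∂μ ≤ B := by
  have e : ∀ x, (∑' i, g i x) ^ 2 = ⨆ s : Finset ι, (∑ i ∈ s, g i x) ^ 2 := fun x => by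
    rw [ENNReal.tsum_eq_iSup_sum]
    exact Monotone.map_iSup_of_continuousAt (f := fun y : ℝ≥0∞ => y ^ 2)
      (ENNReal.continuous_pow 2).continuousAt (fun _ _ h => pow_le_pow_left' h 2) (by simp)
  simp_rw [e]
  rw [lintegral_iSup_directed]
  · exact iSup_le h
  · exact fun s => ((Finset.measurable_fun_sum _ fun i _ => hg i).pow_const 2).aemeasurable
  · classical
    refine Monotone.directed_le fun s t hst x => ?_
    exact pow_le_pow_left' (Finset.sum_le_sum_of_subset hst) 2

/-- The positive dyadic operator with coefficients `a`, applied to the measure `G σ`. -/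
def dyadicOp (a : DyadicInterval → ℝ≥0) (σ : Measure ℝ) (G : ℝ → ℝ≥0∞) (x : ℝ) : ℝ≥0∞ :=
  ∑' I : DyadicInterval, a I * (∫⁻ y in I.toSet, G y ∂σ) * I.toSet.indicator 1 x

/-- The operator is bounded from `L²(σ)` to `L²(μ)`. -/
def OpBound (a : DyadicInterval → ℝ≥0) (σ μ : Measure ℝ) (C : ℝ≥0) : Prop :=
  ∀ G : ℝ → ℝ≥0∞, Measurable G →
    ∫⁻ x, dyadicOp a σ G x ^ 2 ∂μ ≤ C * ∫⁻ x, G x ^ 2 ∂σ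

/-- The bilinear form of the operator is bounded on `L²(μ) × L²(σ)`. -/
def FormBound (a : DyadicInterval → ℝ≥0) (σ μ : Measure ℝ) (C : ℝ≥0) : Prop :=
  ∀ φ ψ : ℝ → ℝ≥0∞, Measurable φ → Measurable ψ → ∫⁻ x, φ x ^ 2 ∂μ ≠ ∞ → ∫⁻ x, ψ x ^ 2 ∂σ ≠ ∞ →
    (∑' I : DyadicInterval, a I * (∫⁻ x in I.toSet, φ x ∂μ) * ∫⁻ x in I.toSet, ψ x ∂σ) ^ 2 ≤
      C * ((∫⁻ x, φ x ^ 2 ∂μ) * ∫⁻ x, ψ x ^ 2 ∂σ)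

/-- The testing condition in terms of measures. -/
def TestBound (a : DyadicInterval → ℝ≥0) (σ μ : Measure ℝ) (C : ℝ≥0) : Prop :=
  ∀ J : DyadicInterval, ∫⁻ x in J.toSet, (∑' I : {I : DyadicInterval // I.toSet ⊆ J.toSet},
    a I.1 * σ I.1.toSet * I.1.toSet.indicator 1 x) ^ 2 ∂μ ≤ C * σ J.toSet

variable {a : DyadicInterval → ℝ≥0} {σ μ : Measure ℝ} {C : ℝ≥0}

@[fun_prop]
theorem measurable_dyadicOp (G : ℝ → ℝ≥0∞) : Measurable (dyadicOp a σ G) := by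
  unfold dyadicOp
  exact Measurable.tsum fun I => (measurable_indicator_toSet I).const_mul _

theorem tsum_form_eq_lintegral {φ : ℝ → ℝ≥0∞} (hφ : Measurable φ) (ψ : ℝ → ℝ≥0∞) :
    ∑' I : DyadicInterval, a I * (∫⁻ x in I.toSet, φ x ∂μ) * ∫⁻ x in I.toSet, ψ x ∂σ =
      ∫⁻ x, φ x * dyadicOp a σ ψ x ∂μ := by
  unfold dyadicOp
  simp_rw [← ENNReal.tsum_mul_left]
  rw [lintegral_tsum fun I =>
    (hφ.fun_mul ((measurable_indicator_toSet I).const_mul _)).aemeasurable]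
  refine tsum_congr fun I => ?_
  rw [← lintegral_mul_indicator_toSet μ φ I, mul_right_comm,
    ← lintegral_const_mul _ (hφ.fun_mul (measurable_indicator_toSet I))]
  exact lintegral_congr fun x => by ring

theorem OpBound.formBound (h : OpBound a σ μ C) : FormBound a σ μ C := by
  intro φ ψ hφ hψ _ _
  rw [tsum_form_eq_lintegral hφ]
  calc (∫⁻ x, φ x * dyadicOp a σ ψ x ∂μ) ^ 2
      ≤ (∫⁻ x, φ x ^ 2 ∂μ) * ∫⁻ x, dyadicOp a σ ψ x ^ 2 ∂μ :=
        lintegral_mul_sq_le _ hφ.aemeasurable (measurable_dyadicOp ψ).aemeasurable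
    _ ≤ (∫⁻ x, φ x ^ 2 ∂μ) * (C * ∫⁻ x, ψ x ^ 2 ∂σ) := by gcongr; exact h ψ hψ
    _ = _ := by ring

theorem FormBound.symm (h : FormBound a σ μ C) : FormBound a μ σ C := by
  intro φ ψ hφ hψ hφ₂ hψ₂
  rw [mul_comm (∫⁻ x, φ x ^ 2 ∂σ)]
  refine le_of_eq_of_le ?_ (h ψ φ hψ hφ hψ₂ hφ₂)
  congr 1
  exact tsum_congr fun I => by ring

/-- The bilinear form of a finite family as an integral. -/
theorem sum_form_eq_lintegral (s : Finset DyadicInterval) (c : DyadicInterval → ℝ≥0∞)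
    {φ : ℝ → ℝ≥0∞} (hφ : Measurable φ) :
    ∑ I ∈ s, c I * ∫⁻ x in I.toSet, φ x ∂μ =
      ∫⁻ x, φ x * ∑ I ∈ s, c I * I.toSet.indicator 1 x ∂μ := by
  simp_rw [Finset.mul_sum]
  rw [lintegral_finsetSum _ fun I _ => hφ.fun_mul ((measurable_indicator_toSet I).const_mul _)]
  refine Finset.sum_congr rfl fun I _ => ?_
  rw [← lintegral_mul_indicator_toSet μ φ I,
    ← lintegral_const_mul _ (hφ.fun_mul (measurable_indicator_toSet I))]
  exact lintegral_congr fun x => by ring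

theorem measurable_sum_indicator (s : Finset DyadicInterval) (c : DyadicInterval → ℝ≥0∞) :
    Measurable fun x => ∑ I ∈ s, c I * I.toSet.indicator 1 x :=
  Finset.measurable_fun_sum _ fun I _ => (measurable_indicator_toSet I).const_mul _

/-- Finiteness is what allows ∫u² to be divided out or absorbed later, and is the reason for working
with finite partial sums. -/
theorem lintegral_sum_indicator_sq_ne_top (hμ : ∀ J : DyadicInterval, μ J.toSet ≠ ∞)
    (s : Finset DyadicInterval) {c : DyadicInterval → ℝ≥0∞} (hc : ∀ I ∈ s, c I ≠ ∞) :
    ∫⁻ x, (∑ I ∈ s, c I * I.toSet.indicator 1 x) ^ 2 ∂μ ≠ ∞ := by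
  simp_rw [sq]
  rw [← sum_form_eq_lintegral s c (measurable_sum_indicator s c)]
  refine ENNReal.sum_ne_top.2 fun I hI => ENNReal.mul_ne_top (hc I hI) ?_
  rw [lintegral_finsetSum _ fun I _ => (measurable_indicator_toSet I).const_mul _]
  refine ENNReal.sum_ne_top.2 fun K hK => ?_
  rw [lintegral_const_mul _ (measurable_indicator_toSet K),
    lintegral_indicator_one K.measurableSet_toSet]
  exact ENNReal.mul_ne_top (hc K hK)
    (ne_top_of_le_ne_top (hμ K) (Measure.restrict_apply_le _ _))

/-- With u a finite partial sum of the local operator on J, the pair (u, χ_J) gives (∫u² dμ)² ≤ C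
∫u² dμ · σ(J); divide by ∫u² dμ. -/
theorem FormBound.testBound (hσ : ∀ J : DyadicInterval, σ J.toSet ≠ ∞)
    (hμ : ∀ J : DyadicInterval, μ J.toSet ≠ ∞) (h : FormBound a σ μ C) : TestBound a σ μ C := by
  intro J
  refine lintegral_tsum_sq_le (g := fun (I : {I : DyadicInterval // I.toSet ⊆ J.toSet}) x =>
    a I.1 * σ I.1.toSet * I.1.toSet.indicator 1 x)
    (fun I => (measurable_indicator_toSet I.1).const_mul _) fun s => ?_
  set F : Finset DyadicInterval := s.map (Function.Embedding.subtype _) with hF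
  have hFJ : ∀ I ∈ F, I.toSet ⊆ J.toSet := by
    intro I hI
    obtain ⟨K, -, rfl⟩ := Finset.mem_map.1 hI
    exact K.2
  have hs : ∀ x, ∑ I ∈ s, (a I.1 : ℝ≥0∞) * σ I.1.toSet * I.1.toSet.indicator 1 x =
      ∑ I ∈ F, a I * σ I.toSet * I.toSet.indicator 1 x := fun x => by
    rw [hF, Finset.sum_map]; rfl
  simp_rw [hs]
  refine (setLIntegral_le_lintegral _ _).trans ?_
  set u : ℝ → ℝ≥0∞ := fun x => ∑ I ∈ F, a I * σ I.toSet * I.toSet.indicator 1 x with hu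
  have hum : Measurable u := measurable_sum_indicator F fun I => a I * σ I.toSet
  have hfin : ∫⁻ x, u x ^ 2 ∂μ ≠ ∞ := lintegral_sum_indicator_sq_ne_top hμ F fun I _ =>
    ENNReal.mul_ne_top ENNReal.coe_ne_top (hσ I)
  have hψ : ∫⁻ x, J.toSet.indicator (1 : ℝ → ℝ≥0∞) x ^ 2 ∂σ = σ J.toSet := by
    rw [← lintegral_indicator_one J.measurableSet_toSet]
    refine lintegral_congr fun x => ?_
    by_cases hx : x ∈ J.toSet <;> simp [hx]
  have key := h u (J.toSet.indicator 1) hum (measurable_indicator_toSet J) hfin (hψ ▸ hσ J)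
  rw [hψ] at key
  -- For I ⊆ J the integral of χ_J over I is σ(I), so the terms in F add up to ∫u² dμ; the others
  -- are nonnegative.
  have hle : ∫⁻ x, u x ^ 2 ∂μ ≤ ∑' I : DyadicInterval, a I * (∫⁻ x in I.toSet, u x ∂μ) *
      ∫⁻ x in I.toSet, J.toSet.indicator 1 x ∂σ := by
    refine le_trans (le_of_eq ?_) (ENNReal.sum_le_tsum F)
    simp_rw [sq]
    rw [hu, ← sum_form_eq_lintegral F _ hum]
    refine Finset.sum_congr rfl fun I hI => ?_
    rw [lintegral_indicator_one J.measurableSet_toSet,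
      Measure.restrict_apply J.measurableSet_toSet, Set.inter_eq_right.2 (hFJ I hI)]
    ring
  have := (pow_le_pow_left' hle 2).trans key
  rcases eq_or_ne (∫⁻ x, u x ^ 2 ∂μ) 0 with h0 | h0
  · rw [h0]; exact zero_le
  · rw [sq, mul_left_comm] at this
    exact (ENNReal.mul_le_mul_iff_right h0 hfin).1 this

/-- The testing integral is monotone in the coefficients and homogeneous of degree two, so dividing
them by κ with κ² ≥ C normalizes the constant to 1. -/
theorem TestBound.localSum_le {F : Finset DyadicInterval} {b : DyadicInterval → ℝ≥0} {κ : ℝ≥0}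
    (hb : ∀ I, κ * b I ≤ a I) (hC : C ≤ κ ^ 2) (hκ : κ ≠ 0) (h : TestBound a σ μ C)
    (J : DyadicInterval) : ∫⁻ x in J.toSet, localSum F b σ J x ^ 2 ∂μ ≤ σ J.toSet := by
  have hκ2 : (κ : ℝ≥0∞) ^ 2 ≠ 0 := by simpa using hκ
  have hκt : (κ : ℝ≥0∞) ^ 2 ≠ ∞ := by simp
  refine (ENNReal.mul_le_mul_iff_right hκ2 hκt).1 ?_
  rw [← lintegral_const_mul _ (by fun_prop)]
  calc ∫⁻ x in J.toSet, (κ : ℝ≥0∞) ^ 2 * localSum F b σ J x ^ 2 ∂μ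
      ≤ ∫⁻ x in J.toSet, (∑' I : {I : DyadicInterval // I.toSet ⊆ J.toSet},
          a I.1 * σ I.1.toSet * I.1.toSet.indicator 1 x) ^ 2 ∂μ := by
        refine lintegral_mono fun x => ?_
        rw [← mul_pow]
        refine pow_le_pow_left' ?_ 2
        rw [localSum, Finset.mul_sum]
        classical
        calc ∑ I ∈ below F J, (κ : ℝ≥0∞) * (b I * σ I.toSet * I.toSet.indicator 1 x)
            ≤ ∑ I ∈ below F J, a I * σ I.toSet * I.toSet.indicator 1 x := by
              refine Finset.sum_le_sum fun I _ => ?_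
              rw [← mul_assoc, ← mul_assoc, ← ENNReal.coe_mul]
              gcongr
              exact hb I
          _ = ∑ I ∈ (below F J).subtype (fun I => I.toSet ⊆ J.toSet),
                a I.1 * σ I.1.toSet * I.1.toSet.indicator 1 x :=
              (Finset.sum_subtype_of_mem
                (fun I => (a I : ℝ≥0∞) * σ I.toSet * I.toSet.indicator 1 x)
                fun I hI => (mem_below.1 hI).2).symm
          _ ≤ _ := ENNReal.sum_le_tsum _
    _ ≤ C * σ J.toSet := h J
    _ ≤ (κ : ℝ≥0∞) ^ 2 * σ J.toSet := by gcongr; exact_mod_cast hC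

/-- Sufficiency of the testing conditions. -/
theorem TestBound.opBound (hσ : ∀ J : DyadicInterval, σ J.toSet ≠ ∞)
    (hμ : ∀ J : DyadicInterval, μ J.toSet ≠ ∞) (h₁ : TestBound a σ μ C)
    (h₂ : TestBound a μ σ C) : OpBound a σ μ (36 * (C + 1) ^ 2) := by
  intro G hG
  -- A positive number with κ² ≥ C, also when C = 0.
  set κ : ℝ≥0 := C + 1 with hκdef
  have hκ : 0 < κ := by positivity
  have hCκ : C ≤ κ ^ 2 := by
    rw [hκdef, add_sq]
    have : C ≤ 2 * C * 1 := by rw [mul_one, two_mul]; exact le_self_add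
    exact (this.trans le_add_self).trans le_self_add
  rcases eq_or_ne (∫⁻ x, G x ^ 2 ∂σ) ∞ with htop | htop
  · rw [htop, ENNReal.mul_top (by simp [hκ.ne'])]; exact le_top
  refine lintegral_tsum_sq_le (fun I => (measurable_indicator_toSet I).const_mul _) fun F => ?_
  have fy := setLIntegral_ne_top_of_sq hG hσ htop
  set u : ℝ → ℝ≥0∞ := fun x =>
    ∑ I ∈ F, a I * (∫⁻ y in I.toSet, G y ∂σ) * I.toSet.indicator 1 x with hu
  have hum : Measurable u := measurable_sum_indicator F fun I => a I * ∫⁻ y in I.toSet, G y ∂σ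
  have hfin : ∫⁻ x, u x ^ 2 ∂μ ≠ ∞ := lintegral_sum_indicator_sq_ne_top hμ F fun I _ =>
    ENNReal.mul_ne_top ENNReal.coe_ne_top (fy I)
  set b : DyadicInterval → ℝ≥0 := fun I => if I ∈ F then a I / κ else 0 with hb
  have hba : ∀ I, κ * b I ≤ a I := fun I => by
    by_cases hI : I ∈ F
    · simp only [hb, hI, if_true]; rw [mul_div_cancel₀ _ hκ.ne']
    · simp [hb, hI]
  -- The form with coefficients a/κ at (tu, G) equals (t/κ)U, where U = ∫u² dμ, and is at most 3(t²U
  -- + ∫G² dσ). This t makes 3t² half of t/κ, so the U on the right is absorbed and U ≤ 36κ² ∫G² dσ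
  -- remains.
  set t : ℝ≥0 := 1 / (6 * κ) with ht
  have e₁ : ∫⁻ x, (t * u x) ^ 2 ∂μ = t ^ 2 * ∫⁻ x, u x ^ 2 ∂μ := by
    rw [← lintegral_const_mul _ (by fun_prop)]
    exact lintegral_congr fun x => by ring
  have key := sum_bilinear_le (F := F) (a := b) (fun I hI => by simp [hb, hI]) hμ hσ
    (h₂.localSum_le hba hCκ hκ.ne') (h₁.localSum_le hba hCκ hκ.ne')
    (φ := fun x => t * u x) (ψ := G) (by fun_prop) hG
    (by rw [e₁]; exact ENNReal.mul_ne_top (by simp) hfin) htop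
  rw [e₁] at key
  have e₂ : ∑ I ∈ F, (b I : ℝ≥0∞) * (∫⁻ x in I.toSet, t * u x ∂μ) * (∫⁻ x in I.toSet, G x ∂σ) =
      (t / κ : ℝ≥0) * ∫⁻ x, u x ^ 2 ∂μ := by
    simp_rw [sq]
    conv_rhs => rw [hu, ← sum_form_eq_lintegral F _ hum]
    rw [Finset.mul_sum]
    refine Finset.sum_congr rfl fun I hI => ?_
    rw [lintegral_const_mul _ hum]
    simp only [hb, hI, if_true]
    have : ((a I / κ : ℝ≥0) : ℝ≥0∞) * t = (t / κ : ℝ≥0) * a I := by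
      rw [← ENNReal.coe_mul, ← ENNReal.coe_mul]; congr 1; field_simp
    calc ((a I / κ : ℝ≥0) : ℝ≥0∞) * (t * ∫⁻ x in I.toSet, u x ∂μ) * ∫⁻ x in I.toSet, G x ∂σ
        = ((a I / κ : ℝ≥0) : ℝ≥0∞) * t * (∫⁻ x in I.toSet, u x ∂μ) *
          ∫⁻ x in I.toSet, G x ∂σ := by ring
      _ = _ := by rw [this]; ring
  rw [e₂] at key
  change ∫⁻ x, u x ^ 2 ∂μ ≤ _
  clear_value u t κ
  lift (∫⁻ x, u x ^ 2 ∂μ) to ℝ≥0 using hfin with U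
  lift (∫⁻ x, G x ^ 2 ∂σ) to ℝ≥0 using htop with Y
  norm_cast at key ⊢
  have key' : (t / κ * U : ℝ) ≤ 3 * (t ^ 2 * U + Y) := by exact_mod_cast key
  have hκ' : (0 : ℝ) < κ := hκ
  have ht' : (t : ℝ) = 1 / (6 * κ) := by rw [ht]; push_cast; rfl
  rw [ht'] at key'
  have k2 := mul_le_mul_of_nonneg_left key' (show (0 : ℝ) ≤ 12 * κ ^ 2 by positivity)
  have l1 : (12 * (κ : ℝ) ^ 2) * (1 / (6 * κ) / κ * U) = 2 * U := by
    field_simp; ring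
  have l2 : (12 * (κ : ℝ) ^ 2) * (3 * ((1 / (6 * κ)) ^ 2 * U + Y)) = U + 36 * κ ^ 2 * Y := by
    field_simp; ring
  rw [l1, l2] at k2
  have : (U : ℝ) ≤ 36 * κ ^ 2 * Y := by linarith
  exact_mod_cast this

end

/-! ### From weights to measures: the kernel and testing conditions. -/

section

variable {v w : ℝ → ℝ≥0} {α : DyadicInterval → ℝ≥0} {C : ℝ≥0}

/-- The coefficients `α_I / |I|²` of the kernel. -/
def kernelCoeff (α : DyadicInterval → ℝ≥0) (I : DyadicInterval) : ℝ≥0 := α I / I.length ^ 2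

theorem IsWeight.measurable_coe (hw : IsWeight w) : Measurable fun x => (w x : ℝ≥0∞) :=
  hw.measurable.coe_nnreal_ennreal

theorem lintegral_weightMeasure (hw : IsWeight w) {f : ℝ → ℝ≥0∞} (hf : Measurable f) :
    ∫⁻ x, f x ∂weightMeasure w = ∫⁻ x, f x * w x := by
  rw [weightMeasure, lintegral_withDensity_eq_lintegral_mul _ hw.measurable_coe hf]
  exact lintegral_congr fun x => by simp [mul_comm]

theorem setLIntegral_weightMeasure (hw : IsWeight w) {f : ℝ → ℝ≥0∞} (hf : Measurable f)
    (I : DyadicInterval) :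
    ∫⁻ x in I.toSet, f x ∂weightMeasure w = ∫⁻ x in I.toSet, f x * w x := by
  rw [weightMeasure,
    setLIntegral_withDensity_eq_setLIntegral_mul _ hw.measurable_coe hf I.measurableSet_toSet]
  exact lintegral_congr fun x => by simp [mul_comm]

theorem weightMeasure_toSet (I : DyadicInterval) :
    weightMeasure w I.toSet = ∫⁻ x in I.toSet, w x :=
  withDensity_apply _ I.measurableSet_toSet

theorem weightMeasure_toSet_ne_top (hw : IsWeight w) (I : DyadicInterval) :
    weightMeasure w I.toSet ≠ ∞ := by
  have h : IntegrableOn (fun x => (w x : ℝ)) I.toSet :=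
    (hw.locallyIntegrable.integrableOn_isCompact isCompact_Icc).mono_set Set.Ico_subset_Icc_self
  have := h.2
  rw [hasFiniteIntegral_iff_enorm] at this
  rw [weightMeasure_toSet]
  refine ne_of_lt (lt_of_le_of_lt (lintegral_mono fun x => ?_) this)
  simp

theorem lintegral_kernel_mul (hw : IsWeight w) {G : ℝ → ℝ≥0∞} (hG : Measurable G) (x : ℝ) :
    ∫⁻ y, kernel α x y * G y * (w y : ℝ≥0∞) =
      dyadicOp (kernelCoeff α) (weightMeasure w) G x := by
  have hm := hw.measurable_coe
  unfold kernel dyadicOp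
  simp_rw [← ENNReal.tsum_mul_right]
  rw [lintegral_tsum fun I => by
    have := measurable_indicator_toSet I
    fun_prop]
  refine tsum_congr fun I => ?_
  rw [setLIntegral_weightMeasure hw hG, ← lintegral_mul_indicator_toSet, mul_right_comm,
    ← lintegral_const_mul _ (by have := measurable_indicator_toSet I; fun_prop)]
  refine lintegral_congr fun y => ?_
  rw [kernelCoeff, ENNReal.coe_div (pow_ne_zero 2 I.length_ne_zero), ENNReal.coe_pow,
    div_eq_mul_inv]
  ring

theorem kernelInequality_iff (hv : IsWeight v) (hw : IsWeight w) :
    KernelInequality v w α ↔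
      ∃ C, OpBound (kernelCoeff α) (weightMeasure w) (weightMeasure v) C := by
  refine exists_congr fun C => forall_congr' fun G => forall_congr' fun hG => ?_
  rw [lintegral_weightMeasure hv (by fun_prop), lintegral_weightMeasure hw (by fun_prop)]
  simp_rw [lintegral_kernel_mul hw hG]

theorem testingCondition_iff (hv : IsWeight v) :
    TestingCondition v w α C ↔
      TestBound (kernelCoeff α) (weightMeasure w) (weightMeasure v) C := by
  refine forall_congr' fun J => ?_
  have hl : ∀ I : DyadicInterval, (I.length : ℝ≥0∞) ≠ 0 := fun I => by
    simpa using I.length_ne_zero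
  have hterm : ∀ (x : ℝ) (I : DyadicInterval), (I.length : ℝ≥0∞)⁻¹ * I.toSet.indicator 1 x *
      (⨍⁻ y in I.toSet, (w y : ℝ≥0∞) ∂volume) * (α I : ℝ≥0∞) =
      kernelCoeff α I * weightMeasure w I.toSet * I.toSet.indicator 1 x := fun x I => by
    rw [setLAverage_eq, volume_toSet, weightMeasure_toSet, kernelCoeff,
      ENNReal.coe_div (pow_ne_zero 2 I.length_ne_zero), ENNReal.coe_pow, div_eq_mul_inv,
      div_eq_mul_inv, ENNReal.inv_pow]
    ring
  simp_rw [hterm]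
  have hm : Measurable fun x => (∑' I : {I : DyadicInterval // I.toSet ⊆ J.toSet},
      kernelCoeff α I.1 * weightMeasure w I.1.toSet * I.1.toSet.indicator 1 x) ^ 2 := by
    refine Measurable.pow_const (Measurable.tsum (f := fun
      (I : {I : DyadicInterval // I.toSet ⊆ J.toSet}) x =>
        kernelCoeff α I.1 * weightMeasure w I.1.toSet * I.1.toSet.indicator 1 x) fun I => ?_) 2
    exact (measurable_indicator_toSet I.1).const_mul _
  rw [setLIntegral_weightMeasure hv hm, setLAverage_eq, setLAverage_eq, volume_toSet,
    weightMeasure_toSet, ← mul_div_assoc]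
  refine ⟨fun h => ?_, fun h => ENNReal.div_le_div_right h _⟩
  have := mul_le_mul_left h (J.length : ℝ≥0∞)
  rwa [ENNReal.div_mul_cancel (hl J) ENNReal.coe_ne_top,
    ENNReal.div_mul_cancel (hl J) ENNReal.coe_ne_top] at this

theorem eLpNorm_two_sq_eq {μ : Measure ℝ} (f : ℝ → ℝ) :
    eLpNorm f 2 μ ^ 2 = ∫⁻ x, ‖f x‖ₑ ^ 2 ∂μ := by
  have := eLpNorm_nnreal_pow_eq_lintegral (μ := μ) (f := f) (p := 2) (by norm_num)
  simpa using this

theorem memLp_two_of_lintegral_ne_top {μ : Measure ℝ} {f : ℝ → ℝ} (hf : AEStronglyMeasurable f μ)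
    (h : ∫⁻ x, ‖f x‖ₑ ^ 2 ∂μ ≠ ∞) : MemLp f 2 μ := by
  refine ⟨hf, lt_top_iff_ne_top.2 fun h' => h ?_⟩
  rw [← eLpNorm_two_sq_eq, h']; simp

theorem enorm_sq_eq_lintegral {μ : Measure ℝ} (f : Lp ℝ 2 μ) :
    ‖f‖ₑ ^ 2 = ∫⁻ x, ‖f x‖ₑ ^ 2 ∂μ := by
  rw [← eLpNorm_two_sq_eq, Lp.enorm_def]

end

/-! ### Averages and the bilinear embedding. -/

section

variable {v w : ℝ → ℝ≥0} {α : DyadicInterval → ℝ≥0} {C : ℝ≥0}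

theorem enorm_length (I : DyadicInterval) : ‖(I.length : ℝ)‖ₑ = I.length := by simp

theorem setAverage_toSet (f : ℝ → ℝ) (I : DyadicInterval) :
    ⨍ x in I.toSet, f x = (I.length : ℝ)⁻¹ * ∫ x in I.toSet, f x := by
  rw [setAverage_eq, measureReal_def, volume_toSet, smul_eq_mul, ENNReal.coe_toReal]

theorem coe_length_inv (I : DyadicInterval) :
    ((I.length⁻¹ : ℝ≥0) : ℝ≥0∞) = (I.length : ℝ≥0∞)⁻¹ := ENNReal.coe_inv I.length_ne_zero

theorem enorm_setAverage_le (f : ℝ → ℝ) (I : DyadicInterval) :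
    ‖⨍ x in I.toSet, f x‖ₑ ≤ (I.length : ℝ≥0∞)⁻¹ * ∫⁻ x in I.toSet, ‖f x‖ₑ := by
  rw [setAverage_toSet, enorm_mul, enorm_inv (by simpa using I.length_ne_zero), enorm_length]
  gcongr
  exact enorm_integral_le_lintegral_enorm _

theorem ofReal_setAverage {f : ℝ → ℝ} (hf : Measurable f) (h₀ : ∀ x, 0 ≤ f x) {I : DyadicInterval}
    (hI : ∫⁻ x in I.toSet, ENNReal.ofReal (f x) ≠ ∞) :
    ENNReal.ofReal (⨍ x in I.toSet, f x) =
      (I.length : ℝ≥0∞)⁻¹ * ∫⁻ x in I.toSet, ENNReal.ofReal (f x) := by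
  rw [setAverage_toSet, ENNReal.ofReal_mul (by positivity), ← NNReal.coe_inv,
    ENNReal.ofReal_coe_nnreal, coe_length_inv,
    integral_eq_lintegral_of_nonneg_ae (Filter.Eventually.of_forall h₀)
      hf.aestronglyMeasurable, ENNReal.ofReal_toReal hI]

theorem ofReal_toReal_mul_coe {p : ℝ≥0∞} {r : ℝ≥0} (h : p ^ 2 * r ≠ ∞) :
    ENNReal.ofReal (p.toReal * r) = p * r := by
  rcases eq_or_ne r 0 with rfl | hr
  · simp
  · have hp : p ≠ ∞ := fun hp => h (by rw [hp]; simp [ENNReal.top_mul, hr])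
    rw [ENNReal.ofReal_mul ENNReal.toReal_nonneg, ENNReal.ofReal_toReal hp,
      ENNReal.ofReal_coe_nnreal]

/-- Square integrability makes φ finite a.e. on {v > 0}; on {v = 0} both sides vanish, even where φ
= ∞. -/
theorem ofReal_toReal_mul_coe_ae {φ : ℝ → ℝ≥0∞} (hv : IsWeight v)
    (hφ : Measurable φ) (h : ∫⁻ x, φ x ^ 2 ∂weightMeasure v ≠ ∞) :
    ∀ᵐ x, ENNReal.ofReal ((φ x).toReal * v x) = φ x * v x := by
  rw [lintegral_weightMeasure hv (by fun_prop)] at h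
  have hm := hv.measurable_coe
  filter_upwards [ae_lt_top (by fun_prop) h] with x hx
  exact ofReal_toReal_mul_coe hx.ne

/-- The function is g = φ v^{1/2}, for which g v^{1/2} dx = φ v dx. -/
theorem exists_lp_of_weighted (hv : IsWeight v) {φ : ℝ → ℝ≥0∞} (hφ : Measurable φ)
    (h : ∫⁻ x, φ x ^ 2 ∂weightMeasure v ≠ ∞) :
    ∃ g : Lp ℝ 2 (volume : Measure ℝ), ‖g‖ₑ ^ 2 ≤ ∫⁻ x, φ x ^ 2 ∂weightMeasure v ∧
      ∀ I : DyadicInterval, 0 ≤ ⨍ x in I.toSet, g x * √(v x) ∧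
        ENNReal.ofReal (⨍ x in I.toSet, g x * √(v x)) =
          (I.length : ℝ≥0∞)⁻¹ * ∫⁻ x in I.toSet, φ x ∂weightMeasure v := by
  have hvm := hv.measurable
  set g : ℝ → ℝ := fun x => (φ x).toReal * √(v x) with hg
  have hgm : Measurable g := by fun_prop
  have hle : ∫⁻ x, ‖g x‖ₑ ^ 2 ≤ ∫⁻ x, φ x ^ 2 ∂weightMeasure v := by
    rw [lintegral_weightMeasure hv (by fun_prop)]
    refine lintegral_mono fun x => ?_
    have : ‖√(v x : ℝ)‖ₑ ^ 2 = (v x : ℝ≥0∞) := by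
      rw [← enorm_pow, Real.sq_sqrt (v x).coe_nonneg]; simp
    simp only [hg]
    rw [enorm_mul, mul_pow, this]
    gcongr
    rw [Real.enorm_of_nonneg ENNReal.toReal_nonneg]
    exact ENNReal.ofReal_toReal_le
  have hgL : MemLp g 2 := memLp_two_of_lintegral_ne_top hgm.aestronglyMeasurable
    (ne_top_of_le_ne_top h hle)
  refine ⟨hgL.toLp g, ?_, fun I => ?_⟩
  · rw [enorm_sq_eq_lintegral]
    refine le_trans (le_of_eq (lintegral_congr_ae ?_)) hle
    filter_upwards [hgL.coeFn_toLp] with x hx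
    rw [hx]
  · have e : ⨍ x in I.toSet, hgL.toLp g x * √(v x) = ⨍ x in I.toSet, (φ x).toReal * v x := by
      rw [setAverage_toSet, setAverage_toSet]
      congr 1
      refine integral_congr_ae (ae_restrict_of_ae ?_)
      filter_upwards [hgL.coeFn_toLp] with x hx
      rw [hx]
      simp only [hg]
      rw [mul_assoc, Real.mul_self_sqrt (v x).coe_nonneg]
    have e₂ : ∫⁻ x in I.toSet, ENNReal.ofReal ((φ x).toReal * v x) =
        ∫⁻ x in I.toSet, φ x ∂weightMeasure v := by
      rw [setLIntegral_weightMeasure hv hφ]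
      exact lintegral_congr_ae (ae_restrict_of_ae (ofReal_toReal_mul_coe_ae hv hφ h))
    rw [e]
    constructor
    · rw [setAverage_toSet]
      exact mul_nonneg (by positivity) (integral_nonneg fun x => by positivity)
    · rw [ofReal_setAverage (by fun_prop) (fun x => by positivity), e₂]
      rw [e₂]
      exact setLIntegral_ne_top_of_sq hφ (weightMeasure_toSet_ne_top hv) h I

/-- The converse substitution φ = |g| v^{-1/2}. Where v = 0 this may be ∞, but v dx does not charge
that set, and g v^{1/2} is 0 there. -/
theorem exists_weighted_of_lp (hv : IsWeight v) (g : Lp ℝ 2 (volume : Measure ℝ)) :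
    ∃ φ : ℝ → ℝ≥0∞, Measurable φ ∧ ∫⁻ x, φ x ^ 2 ∂weightMeasure v ≤ ‖g‖ₑ ^ 2 ∧
      ∀ I : DyadicInterval, ‖⨍ x in I.toSet, g x * √(v x)‖ₑ ≤
        (I.length : ℝ≥0∞)⁻¹ * ∫⁻ x in I.toSet, φ x ∂weightMeasure v := by
  have hvm := hv.measurable
  have hgm : Measurable g := (Lp.stronglyMeasurable g).measurable
  have hsq : ∀ x, ‖√(v x : ℝ)‖ₑ = (NNReal.sqrt (v x) : ℝ≥0∞) := fun x => by
    rw [← Real.coe_sqrt, Real.enorm_of_nonneg NNReal.zero_le_coe, ENNReal.ofReal_coe_nnreal]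
  have hvv : ∀ x, (v x : ℝ≥0∞) = (NNReal.sqrt (v x) : ℝ≥0∞) * NNReal.sqrt (v x) := fun x => by
    rw [← ENNReal.coe_mul, NNReal.mul_self_sqrt]
  have hφm : Measurable fun x => ‖g x‖ₑ * (NNReal.sqrt (v x) : ℝ≥0∞)⁻¹ := by fun_prop
  refine ⟨fun x => ‖g x‖ₑ * (NNReal.sqrt (v x) : ℝ≥0∞)⁻¹, hφm, ?_, fun I => ?_⟩
  · rw [enorm_sq_eq_lintegral, lintegral_weightMeasure hv (by fun_prop)]
    refine lintegral_mono fun x => ?_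
    rw [hvv x]
    rcases eq_or_ne (NNReal.sqrt (v x)) 0 with h0 | h0
    · simp [h0]
    · have h1 : (NNReal.sqrt (v x) : ℝ≥0∞) ≠ 0 := by exact_mod_cast h0
      calc (‖g x‖ₑ * (NNReal.sqrt (v x) : ℝ≥0∞)⁻¹) ^ 2 *
            ((NNReal.sqrt (v x) : ℝ≥0∞) * NNReal.sqrt (v x))
          = ‖g x‖ₑ ^ 2 * ((NNReal.sqrt (v x) : ℝ≥0∞)⁻¹ * NNReal.sqrt (v x)) ^ 2 := by ring
        _ = ‖g x‖ₑ ^ 2 := by rw [ENNReal.inv_mul_cancel h1 ENNReal.coe_ne_top]; simp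
        _ ≤ _ := le_rfl
  · refine (enorm_setAverage_le _ I).trans ?_
    refine mul_le_mul_right ?_ _
    rw [setLIntegral_weightMeasure hv hφm]
    refine lintegral_mono fun x => ?_
    rw [enorm_mul, hsq, hvv x]
    rcases eq_or_ne (NNReal.sqrt (v x)) 0 with h0 | h0
    · simp [h0]
    · have h1 : (NNReal.sqrt (v x) : ℝ≥0∞) ≠ 0 := by exact_mod_cast h0
      calc ‖g x‖ₑ * (NNReal.sqrt (v x) : ℝ≥0∞)
          = ‖g x‖ₑ * ((NNReal.sqrt (v x) : ℝ≥0∞)⁻¹ * NNReal.sqrt (v x)) *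
            NNReal.sqrt (v x) := by
              rw [ENNReal.inv_mul_cancel h1 ENNReal.coe_ne_top, mul_one]
        _ = _ := by ring
        _ ≤ _ := le_rfl

theorem kernelCoeff_mul (p q : ℝ≥0∞) (I : DyadicInterval) :
    (kernelCoeff α I : ℝ≥0∞) * p * q =
      ((I.length : ℝ≥0∞)⁻¹ * p) * ((I.length : ℝ≥0∞)⁻¹ * q) * α I := by
  rw [kernelCoeff, ENNReal.coe_div (pow_ne_zero 2 I.length_ne_zero), ENNReal.coe_pow,
    div_eq_mul_inv, ENNReal.inv_pow]
  ring

theorem bilinearEmbedding_iff (hv : IsWeight v) (hw : IsWeight w) :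
    BilinearEmbedding v w α ↔
      ∃ C, FormBound (kernelCoeff α) (weightMeasure w) (weightMeasure v) C := by
  constructor
  · rintro ⟨C, hC⟩
    refine ⟨C ^ 2, fun φ ψ hφ hψ hφ₂ hψ₂ => ?_⟩
    obtain ⟨g, hg, hgI⟩ := exists_lp_of_weighted hv hφ hφ₂
    obtain ⟨f, hf, hfI⟩ := exists_lp_of_weighted hw hψ hψ₂
    obtain ⟨hs, hle⟩ := hC f g
    have e : ∑' I : DyadicInterval, kernelCoeff α I * (∫⁻ x in I.toSet, φ x ∂weightMeasure v) *
        (∫⁻ x in I.toSet, ψ x ∂weightMeasure w) = ENNReal.ofReal (∑' I : DyadicInterval,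
        (⨍ x in I.toSet, g x * √(v x)) * (⨍ x in I.toSet, f x * √(w x)) * (α I : ℝ)) := by
      rw [ENNReal.ofReal_tsum_of_nonneg
        (fun I => mul_nonneg (mul_nonneg (hgI I).1 (hfI I).1) (α I).coe_nonneg) hs]
      refine tsum_congr fun I => ?_
      rw [kernelCoeff_mul, ENNReal.ofReal_mul (mul_nonneg (hgI I).1 (hfI I).1),
        ENNReal.ofReal_mul (hgI I).1, (hgI I).2, (hfI I).2, ENNReal.ofReal_coe_nnreal]
    calc _ ≤ (C * ‖g‖ₑ * ‖f‖ₑ) ^ 2 := by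
          rw [e]
          refine pow_le_pow_left' ((ENNReal.ofReal_le_ofReal hle).trans_eq ?_) 2
          rw [ENNReal.ofReal_mul (by positivity), ENNReal.ofReal_mul (by positivity),
            ofReal_norm, ofReal_norm, ENNReal.ofReal_coe_nnreal]
      _ = (C ^ 2 : ℝ≥0) * (‖g‖ₑ ^ 2 * ‖f‖ₑ ^ 2) := by push_cast; ring
      _ ≤ _ := by gcongr
  · rintro ⟨C, hC⟩
    refine ⟨NNReal.sqrt C, fun f g => ?_⟩
    obtain ⟨φ, hφ, hφ₂, hφI⟩ := exists_weighted_of_lp hv g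
    obtain ⟨ψ, hψ, hψ₂, hψI⟩ := exists_weighted_of_lp hw f
    have key := hC φ ψ hφ hψ (ne_top_of_le_ne_top (by simp) hφ₂)
      (ne_top_of_le_ne_top (by simp) hψ₂)
    set T := ∑' I : DyadicInterval, kernelCoeff α I * (∫⁻ x in I.toSet, φ x ∂weightMeasure v) *
        (∫⁻ x in I.toSet, ψ x ∂weightMeasure w)
    have hT : T ≤ NNReal.sqrt C * ‖g‖ₑ * ‖f‖ₑ := by
      refine (ENNReal.pow_le_pow_left_iff two_ne_zero).1 (key.trans ?_)
      calc (C : ℝ≥0∞) * ((∫⁻ x, φ x ^ 2 ∂weightMeasure v) * ∫⁻ x, ψ x ^ 2 ∂weightMeasure w)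
          ≤ C * (‖g‖ₑ ^ 2 * ‖f‖ₑ ^ 2) := by gcongr
        _ = ((NNReal.sqrt C ^ 2 : ℝ≥0) : ℝ≥0∞) * (‖g‖ₑ ^ 2 * ‖f‖ₑ ^ 2) := by rw [NNReal.sq_sqrt]
        _ = _ := by push_cast; ring
    have hterm : ∀ I : DyadicInterval,
        ‖(⨍ x in I.toSet, g x * √(v x)) * (⨍ x in I.toSet, f x * √(w x)) * (α I : ℝ)‖ₑ ≤
          kernelCoeff α I * (∫⁻ x in I.toSet, φ x ∂weightMeasure v) *
            (∫⁻ x in I.toSet, ψ x ∂weightMeasure w) := fun I => by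
      rw [kernelCoeff_mul, enorm_mul, enorm_mul]
      gcongr
      · exact hφI I
      · exact hψI I
      · simp
    have hsum := ENNReal.tsum_le_tsum hterm
    have hfin : (NNReal.sqrt C * ‖g‖ₑ * ‖f‖ₑ : ℝ≥0∞) ≠ ∞ :=
      ENNReal.mul_ne_top (ENNReal.mul_ne_top ENNReal.coe_ne_top (by simp)) (by simp)
    refine ⟨Summable.of_enorm (ne_top_of_le_ne_top hfin (hsum.trans hT)), ?_⟩
    refine (le_abs_self _).trans ?_
    rw [← Real.norm_eq_abs, ← toReal_enorm]
    refine (ENNReal.toReal_mono hfin (enorm_tsum_le_tsum_enorm.trans (hsum.trans hT))).trans_eq ?_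
    simp

end

/-! ### The operator T₀ on L²(w⁻¹). -/

section

variable {v w : ℝ → ℝ≥0} {α : DyadicInterval → ℝ≥0} {C : ℝ≥0}

/-- The density w⁻¹ is nowhere zero because w is finite. Hence the averages of a class in L²(w⁻¹) do
not depend on its representative. -/
theorem volume_absolutelyContinuous_invWeightMeasure (hw : IsWeight w) :
    volume ≪ invWeightMeasure w :=
  withDensity_absolutelyContinuous' hw.measurable_coe.inv.aemeasurable
    (Filter.Eventually.of_forall fun x => by simp)

theorem lintegral_invWeightMeasure (hw : IsWeight w) {f : ℝ → ℝ≥0∞} (hf : Measurable f) :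
    ∫⁻ x, f x ∂invWeightMeasure w = ∫⁻ x, f x * (w x : ℝ≥0∞)⁻¹ := by
  rw [invWeightMeasure, lintegral_withDensity_eq_lintegral_mul _ (hw.measurable_coe.fun_inv) hf]
  exact lintegral_congr fun x => by simp [mul_comm]

theorem T0term_congr {f g : ℝ → ℝ} (h : f =ᵐ[volume] g) (x : ℝ) :
    T0term α f x = T0term α g x := by
  funext I
  rw [T0term, T0term, setAverage_toSet, setAverage_toSet,
    integral_congr_ae (ae_restrict_of_ae h)]

theorem enorm_indicator_toSet (I : DyadicInterval) (x : ℝ) :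
    ‖I.toSet.indicator (1 : ℝ → ℝ) x‖ₑ = I.toSet.indicator 1 x := by
  by_cases hx : x ∈ I.toSet <;> simp [hx]

theorem kernelCoeff_mul_indicator (p : ℝ≥0∞) (I : DyadicInterval) (x : ℝ) :
    (kernelCoeff α I : ℝ≥0∞) * p * I.toSet.indicator 1 x =
      (I.length : ℝ≥0∞)⁻¹ * ((I.length : ℝ≥0∞)⁻¹ * p) * I.toSet.indicator 1 x * α I := by
  rw [kernelCoeff, ENNReal.coe_div (pow_ne_zero 2 I.length_ne_zero), ENNReal.coe_pow,
    div_eq_mul_inv, ENNReal.inv_pow]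
  ring

theorem enorm_T0term (f : ℝ → ℝ) (x : ℝ) (I : DyadicInterval) :
    ‖T0term α f x I‖ₑ =
      (I.length : ℝ≥0∞)⁻¹ * ‖⨍ y in I.toSet, f y‖ₑ * I.toSet.indicator 1 x * α I := by
  rw [T0term, enorm_mul, enorm_mul, enorm_mul, enorm_indicator_toSet,
    enorm_inv (by simpa using I.length_ne_zero), enorm_length]
  simp

theorem enorm_T0term_le (f : ℝ → ℝ) (x : ℝ) (I : DyadicInterval) :
    ‖T0term α f x I‖ₑ ≤
      kernelCoeff α I * (∫⁻ y in I.toSet, ‖f y‖ₑ) * I.toSet.indicator 1 x := by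
  rw [enorm_T0term, kernelCoeff_mul_indicator]
  gcongr
  exact enorm_setAverage_le f I

theorem measurable_T0term (f : ℝ → ℝ) (I : DyadicInterval) :
    Measurable fun x => T0term α f x I := by
  unfold T0term
  exact ((measurable_one.indicator I.measurableSet_toSet).const_mul _).mul_const _

/-- Apply T₀ to f = Gw, whose norm in L²(w⁻¹) is at most that of G in L²(w). All terms are
nonnegative, so the real sum equals the sum in [0, ∞]. -/
theorem T0Bounded.exists_opBound (hw : IsWeight w) (h : T0Bounded v w α) :
    ∃ C, OpBound (kernelCoeff α) (weightMeasure w) (weightMeasure v) C := by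
  obtain ⟨T, hT⟩ := h
  -- The summand 1 keeps the constant nonzero, so that the right side is ∞ when ∫G²w = ∞.
  refine ⟨‖T‖₊ ^ 2 + 1, fun G hG => ?_⟩
  rcases eq_or_ne (∫⁻ x, G x ^ 2 ∂weightMeasure w) ∞ with htop | htop
  · rw [htop, ENNReal.mul_top (by simp)]; exact le_top
  have hwm := hw.measurable
  set f : ℝ → ℝ := fun x => (G x).toReal * w x with hf
  have hfm : Measurable f := by fun_prop
  have hf₀ : ∀ x, 0 ≤ f x := fun x => by positivity
  have hle : ∫⁻ x, ‖f x‖ₑ ^ 2 ∂invWeightMeasure w ≤ ∫⁻ x, G x ^ 2 ∂weightMeasure w := by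
    rw [lintegral_weightMeasure hw (by fun_prop), lintegral_invWeightMeasure hw (by fun_prop)]
    refine lintegral_mono fun x => ?_
    simp only [hf]
    rw [enorm_mul, Real.enorm_of_nonneg ENNReal.toReal_nonneg,
      Real.enorm_of_nonneg NNReal.zero_le_coe, ENNReal.ofReal_coe_nnreal]
    rcases eq_or_ne (w x) 0 with h0 | h0
    · simp [h0]
    · have h1 : (w x : ℝ≥0∞) ≠ 0 := by exact_mod_cast h0
      calc (ENNReal.ofReal (G x).toReal * w x) ^ 2 * (w x : ℝ≥0∞)⁻¹
          = ENNReal.ofReal (G x).toReal ^ 2 * w x * (w x * (w x : ℝ≥0∞)⁻¹) := by ring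
        _ = ENNReal.ofReal (G x).toReal ^ 2 * w x := by
            rw [ENNReal.mul_inv_cancel h1 ENNReal.coe_ne_top, mul_one]
        _ ≤ _ := by gcongr; exact ENNReal.ofReal_toReal_le
  have hfL : MemLp f 2 (invWeightMeasure w) :=
    memLp_two_of_lintegral_ne_top hfm.aestronglyMeasurable (ne_top_of_le_ne_top htop hle)
  have hcongr := (volume_absolutelyContinuous_invWeightMeasure hw).ae_eq hfL.coeFn_toLp
  have e₂ : ∀ I : DyadicInterval, ∫⁻ x in I.toSet, ENNReal.ofReal (f x) =
      ∫⁻ x in I.toSet, G x ∂weightMeasure w := fun I => by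
    rw [setLIntegral_weightMeasure hw hG]
    exact lintegral_congr_ae (ae_restrict_of_ae (ofReal_toReal_mul_coe_ae hw hG htop))
  have avg₀ : ∀ I : DyadicInterval, 0 ≤ ⨍ y in I.toSet, f y := fun I => by
    rw [setAverage_toSet]
    exact mul_nonneg (by positivity) (integral_nonneg hf₀)
  have hterm : ∀ x I, ‖T0term α f x I‖ₑ = kernelCoeff α I *
      (∫⁻ y in I.toSet, G y ∂weightMeasure w) * I.toSet.indicator 1 x := fun x I => by
    rw [enorm_T0term, Real.enorm_of_nonneg (avg₀ I), ofReal_setAverage hfm hf₀, e₂,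
      kernelCoeff_mul_indicator]
    rw [e₂]
    exact setLIntegral_ne_top_of_sq hG (weightMeasure_toSet_ne_top hw) htop I
  have hterm₀ : ∀ x I, 0 ≤ T0term α f x I := fun x I => by
    have : (0 : ℝ) ≤ I.toSet.indicator 1 x := Set.indicator_nonneg (fun _ _ => zero_le_one) x
    have := avg₀ I
    unfold T0term
    positivity
  have hop : ∀ᵐ x ∂weightMeasure v, dyadicOp (kernelCoeff α) (weightMeasure w) G x ^ 2 =
      ‖T (hfL.toLp f) x‖ₑ ^ 2 := by
    filter_upwards [hT (hfL.toLp f)] with x hx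
    rw [T0term_congr hcongr] at hx
    congr 1
    rw [← hx.tsum_eq, Real.enorm_of_nonneg (tsum_nonneg (hterm₀ x)),
      ENNReal.ofReal_tsum_of_nonneg (hterm₀ x) hx.summable]
    refine tsum_congr fun I => ?_
    rw [← hterm, Real.enorm_of_nonneg (hterm₀ x I)]
  rw [lintegral_congr_ae hop, ← enorm_sq_eq_lintegral]
  calc ‖T (hfL.toLp f)‖ₑ ^ 2 ≤ (‖T‖ₑ * ‖hfL.toLp f‖ₑ) ^ 2 :=
        pow_le_pow_left' (T.le_opENorm _) 2
    _ = ‖T‖ₑ ^ 2 * ∫⁻ x, ‖f x‖ₑ ^ 2 ∂invWeightMeasure w := by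
        rw [mul_pow, enorm_sq_eq_lintegral]
        congr 1
        refine lintegral_congr_ae ?_
        filter_upwards [hfL.coeFn_toLp] with x hx
        rw [hx]
    _ ≤ (‖T‖ₑ ^ 2 + 1) * ∫⁻ x, G x ^ 2 ∂weightMeasure w := by
        gcongr
        exact le_self_add
    _ = _ := by push_cast; rfl

/-- A function in `L²(w⁻¹)` is `G w` for some `G` in `L²(w)`, up to its sign. -/
theorem exists_weighted_of_lp_inv (hw : IsWeight w) (f : Lp ℝ 2 (invWeightMeasure w)) :
    ∃ G : ℝ → ℝ≥0∞, Measurable G ∧ ∫⁻ x, G x ^ 2 ∂weightMeasure w ≤ ‖f‖ₑ ^ 2 ∧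
      ∀ I : DyadicInterval,
        ∫⁻ x in I.toSet, ‖f x‖ₑ ≤ ∫⁻ x in I.toSet, G x ∂weightMeasure w := by
  have hwm := hw.measurable
  have hfm : Measurable f := (Lp.stronglyMeasurable f).measurable
  have hG : Measurable fun x => ‖f x‖ₑ * (w x : ℝ≥0∞)⁻¹ := by fun_prop
  have hsq : ‖f‖ₑ ^ 2 = ∫⁻ x, ‖f x‖ₑ ^ 2 * (w x : ℝ≥0∞)⁻¹ := by
    rw [enorm_sq_eq_lintegral, lintegral_invWeightMeasure hw (by fun_prop)]
  have hae : ∀ᵐ x, ‖f x‖ₑ ^ 2 * (w x : ℝ≥0∞)⁻¹ < ∞ :=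
    ae_lt_top (by fun_prop) (by rw [← hsq]; simp)
  refine ⟨_, hG, ?_, fun I => ?_⟩
  · rw [hsq, lintegral_weightMeasure hw (by fun_prop)]
    refine lintegral_mono fun x => ?_
    rcases eq_or_ne (w x) 0 with h0 | h0
    · simp [h0]
    · have h1 : (w x : ℝ≥0∞) ≠ 0 := by exact_mod_cast h0
      calc (‖f x‖ₑ * (w x : ℝ≥0∞)⁻¹) ^ 2 * w x
          = ‖f x‖ₑ ^ 2 * (w x : ℝ≥0∞)⁻¹ * (w x * (w x : ℝ≥0∞)⁻¹) := by ring
        _ ≤ _ := by rw [ENNReal.mul_inv_cancel h1 ENNReal.coe_ne_top, mul_one]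
  · rw [setLIntegral_weightMeasure hw hG]
    refine lintegral_mono_ae (ae_restrict_of_ae ?_)
    filter_upwards [hae] with x hx
    -- Where w = 0 the weight w⁻¹ is ∞, and finiteness of |f|² w⁻¹ forces f = 0.
    rcases eq_or_ne (w x) 0 with h0 | h0
    · have : ‖f x‖ₑ = 0 := by
        by_contra h1
        simp [h0, ENNReal.mul_top, h1] at hx
      simp [this]
    · have h1 : (w x : ℝ≥0∞) ≠ 0 := by exact_mod_cast h0
      rw [mul_assoc, ENNReal.inv_mul_cancel h1 ENNReal.coe_ne_top, mul_one]

/-- Bounding the sum of absolute values yields both the a.e. absolute convergence of the series and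
the norm estimate. -/
theorem OpBound.lintegral_tsum_enorm_T0term_le
    (h : OpBound (kernelCoeff α) (weightMeasure w) (weightMeasure v) C) (hw : IsWeight w)
    (f : Lp ℝ 2 (invWeightMeasure w)) :
    ∫⁻ x, (∑' I, ‖T0term α f x I‖ₑ) ^ 2 ∂weightMeasure v ≤ C * ‖f‖ₑ ^ 2 := by
  obtain ⟨G, hG, hG₂, hGI⟩ := exists_weighted_of_lp_inv hw f
  calc _ ≤ ∫⁻ x, dyadicOp (kernelCoeff α) (weightMeasure w) G x ^ 2 ∂weightMeasure v := by
        refine lintegral_mono fun x => pow_le_pow_left' (ENNReal.tsum_le_tsum fun I => ?_) 2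
        refine (enorm_T0term_le _ x I).trans ?_
        exact mul_le_mul_left (mul_le_mul_right (hGI I) _) _
    _ ≤ C * ∫⁻ x, G x ^ 2 ∂weightMeasure w := h G hG
    _ ≤ _ := by gcongr

theorem OpBound.ae_summable
    (h : OpBound (kernelCoeff α) (weightMeasure w) (weightMeasure v) C) (hw : IsWeight w)
    (f : Lp ℝ 2 (invWeightMeasure w)) :
    ∀ᵐ x ∂weightMeasure v, Summable (T0term α f x) := by
  have hm : Measurable fun x => (∑' I, ‖T0term α f x I‖ₑ) ^ 2 :=
    (Measurable.tsum fun I => (measurable_T0term f I).enorm).pow_const 2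
  filter_upwards [ae_lt_top hm (ne_top_of_le_ne_top (by finiteness)
    (h.lintegral_tsum_enorm_T0term_le hw f))] with x hx
  refine Summable.of_enorm fun h' => ?_
  rw [h'] at hx
  simp at hx

theorem OpBound.lintegral_tsum_T0term_le
    (h : OpBound (kernelCoeff α) (weightMeasure w) (weightMeasure v) C) (hw : IsWeight w)
    (f : Lp ℝ 2 (invWeightMeasure w)) :
    ∫⁻ x, ‖∑' I, T0term α f x I‖ₑ ^ 2 ∂weightMeasure v ≤ C * ‖f‖ₑ ^ 2 :=
  (lintegral_mono fun _ => pow_le_pow_left' enorm_tsum_le_tsum_enorm 2).trans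
    (h.lintegral_tsum_enorm_T0term_le hw f)

theorem OpBound.memLp
    (h : OpBound (kernelCoeff α) (weightMeasure w) (weightMeasure v) C) (hw : IsWeight w)
    (f : Lp ℝ 2 (invWeightMeasure w)) :
    MemLp (fun x => ∑' I, T0term α f x I) 2 (weightMeasure v) :=
  memLp_two_of_lintegral_ne_top
    (Measurable.tsum fun I => measurable_T0term f I).aestronglyMeasurable
    (ne_top_of_le_ne_top (by finiteness) (h.lintegral_tsum_T0term_le hw f))

theorem integrableOn_toSet_of_lp_inv (hw : IsWeight w) (f : Lp ℝ 2 (invWeightMeasure w))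
    (I : DyadicInterval) : IntegrableOn f I.toSet := by
  obtain ⟨G, hG, hG₂, hGI⟩ := exists_weighted_of_lp_inv hw f
  refine ⟨(Lp.stronglyMeasurable f).aestronglyMeasurable, ?_⟩
  rw [hasFiniteIntegral_iff_enorm]
  exact (hGI I).trans_lt (lt_top_iff_ne_top.2 (setLIntegral_ne_top_of_sq hG
    (weightMeasure_toSet_ne_top hw) (ne_top_of_le_ne_top (by finiteness) hG₂) I))

theorem T0term_add (hw : IsWeight w) (f g : Lp ℝ 2 (invWeightMeasure w)) (x : ℝ) :
    T0term α (f + g : Lp ℝ 2 (invWeightMeasure w)) x = T0term α f x + T0term α g x := by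
  rw [T0term_congr
    ((volume_absolutelyContinuous_invWeightMeasure hw).ae_eq (Lp.coeFn_add f g))]
  funext I
  simp only [T0term, Pi.add_apply, setAverage_toSet]
  rw [integral_add (integrableOn_toSet_of_lp_inv hw f I) (integrableOn_toSet_of_lp_inv hw g I)]
  ring

theorem T0term_smul (hw : IsWeight w) (c : ℝ) (f : Lp ℝ 2 (invWeightMeasure w)) (x : ℝ) :
    T0term α (c • f : Lp ℝ 2 (invWeightMeasure w)) x = c • T0term α f x := by
  rw [T0term_congr
    ((volume_absolutelyContinuous_invWeightMeasure hw).ae_eq (Lp.coeFn_smul c f))]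
  funext I
  simp only [T0term, Pi.smul_apply, setAverage_toSet, smul_eq_mul]
  rw [integral_const_mul]
  ring

theorem OpBound.t0Bounded (hw : IsWeight w)
    (h : OpBound (kernelCoeff α) (weightMeasure w) (weightMeasure v) C) : T0Bounded v w α := by
  let T : Lp ℝ 2 (invWeightMeasure w) →ₗ[ℝ] Lp ℝ 2 (weightMeasure v) :=
    { toFun := fun f => (h.memLp hw f).toLp _
      map_add' := fun f g => by
        rw [← MemLp.toLp_add, MemLp.toLp_eq_toLp_iff]
        filter_upwards [h.ae_summable hw f, h.ae_summable hw g] with x hf hg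
        simp only [T0term_add hw, Pi.add_apply]
        exact hf.tsum_add hg
      map_smul' := fun c f => by
        rw [RingHom.id_apply, ← MemLp.toLp_const_smul, MemLp.toLp_eq_toLp_iff]
        refine Filter.Eventually.of_forall fun x => ?_
        simp only [T0term_smul hw, Pi.smul_apply, smul_eq_mul]
        exact tsum_mul_left }
  have hT : ∀ f, ‖T f‖ ≤ NNReal.sqrt C * ‖f‖ := fun f => by
    have h1 : ‖T f‖ₑ ^ 2 ≤ (NNReal.sqrt C * ‖f‖ₑ) ^ 2 := by
      rw [enorm_sq_eq_lintegral, mul_pow, ← ENNReal.coe_pow, NNReal.sq_sqrt]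
      refine le_trans (le_of_eq (lintegral_congr_ae ?_)) (h.lintegral_tsum_T0term_le hw f)
      filter_upwards [(h.memLp hw f).coeFn_toLp] with x hx
      change ‖((h.memLp hw f).toLp _ : ℝ → ℝ) x‖ₑ ^ 2 = _
      rw [hx]
    have h2 := (ENNReal.pow_le_pow_left_iff two_ne_zero).1 h1
    have h3 := ENNReal.toReal_mono (by finiteness) h2
    simpa using h3
  refine ⟨T.mkContinuous _ hT, fun f => ?_⟩
  filter_upwards [h.ae_summable hw f, (h.memLp hw f).coeFn_toLp] with x hx hx'
  have : (T.mkContinuous _ hT f : ℝ → ℝ) x = ∑' I, T0term α f x I := hx'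
  rw [this]
  exact hx.hasSum

end

end DyadicTwoWeight

end

/-! ### The equivalence. -/

open DyadicTwoWeight in
theorem theorem0p3 (v w : ℝ → NNReal)
    (hv : DyadicTwoWeight.IsWeight v) (hw : DyadicTwoWeight.IsWeight w)
    (α : DyadicTwoWeight.DyadicInterval → NNReal) :
    List.TFAE
      [DyadicTwoWeight.T0Bounded v w α,
       DyadicTwoWeight.BilinearEmbedding v w α,
       DyadicTwoWeight.KernelInequality v w α,
       ∃ C : NNReal, DyadicTwoWeight.TestingCondition v w α C ∧
         DyadicTwoWeight.TestingCondition w v α C] := by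
  have hv' := weightMeasure_toSet_ne_top hv
  have hw' := weightMeasure_toSet_ne_top hw
  rw [bilinearEmbedding_iff hv hw, kernelInequality_iff hv hw]
  simp_rw [testingCondition_iff hv, testingCondition_iff hw]
  tfae_have 1 → 3 := fun h => h.exists_opBound hw
  tfae_have 3 → 1 := fun ⟨_, h⟩ => h.t0Bounded hw
  tfae_have 3 → 2 := fun ⟨C, h⟩ => ⟨C, h.formBound⟩
  -- The form is symmetric under exchanging the two measures, so one bound gives both testing
  -- conditions.
  tfae_have 2 → 4 := fun ⟨C, h⟩ => ⟨C, h.testBound hw' hv', h.symm.testBound hv' hw'⟩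
  tfae_have 4 → 3 := fun ⟨_, h₁, h₂⟩ => ⟨_, h₁.opBound hw' hv' h₂⟩
  tfae_finish
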